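/- **Conventions.** All discrete groups are countable. A *coupling* of discrete groups $\Gamma,\Lambda$ is a standard Borel space $\Sigma$ with a non-zero $\sigma$-finite measure $m$ and a Borel measure-preserving action of $\Gamma\times\Lambda$, such that there are Borel sets $X,Y\subset\Sigma$ of finite measure with $\Sigma=\bigsqcup_{\gamma\in\Gamma}\gamma Y=\bigsqcup_{\lambda\in\Lambda}\lambda X$ up to null sets. For a standard Borel group $G$ and homomorphisms $\pi\colon\Gamma\to G$, $\rho\colon\Lambda\to G$, a Borel map $\Phi\colon\Sigma\to G$ is *almost equivariant into $(G,\pi,\rho)$* if for all $(\gamma,\lambda)\in\Gamma\times\Lambda$ we have $\Phi((\gamma,\lambda)x)=\pi(\gamma)\Phi(x)\rho(\lambda)^{-1}$ for a.e. $x$. The group $\Gamma$ is *coupling rigid* with respect to $(G,\pi)$ if every coupling of $\Gamma$ with itself admits an almost equivariant Borel map into $(G,\pi,\pi)$ and the Dirac measure at the neutral element is the only probability measure on $G$ invariant under conjugation by $\pi(\Gamma)$. A measure is *atomic* if some countable set has null complement. For subgroups, $\Delta_1\asymp\Delta_2$ means that $\Delta_1\cap\Delta_2$ has finite index in both. Put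 $\mathrm{LQN}_H(K)=\{h\in H\mid [K:hKh^{-1}\cap K]<\infty\}$. **Setting (Assumption $(\bullet)$).** Let $\Gamma=\Gamma_1*_A\Gamma_2$ be an amalgamated free product of discrete groups, and let $A_i<\Gamma_i$ be the copy of $A$ in $\Gamma_i$. Let $T$ be the Bass–Serre tree, with vertex set $V(T)=V_1(T)\sqcup V_2(T)$, $V_i(T)=\Gamma/\Gamma_i$, and an edge $\gamma A$ from $\gamma\Gamma_1$ to $\gamma\Gamma_2$ for each $\gamma A\in\Gamma/A$. Let $\mathrm{Aut}(T)$ be the group of orientation-preserving simplicial automorphisms of $T$, with the Borel structure of the pointwise convergence topology, and let $\imath\colon\Gamma\to\mathrm{Aut}(T)$ be given by left multiplication. Let $(\Sigma,m)$ be a coupling of $\Gamma$ and a discrete group $\Lambda$, let $\rho\colon\Lambda\to\mathrm{Aut}(T)$ be a homomorphism and let $\Phi\colon\Sigma\to(\mathrm{Aut}(T),\imath,\rho)$ be an almost equivariant Borel map. For $v\in V(T)$ let $\mathrm{Stab}(v)$, $\Gamma_v$, $\Lambda_v$ be the stabilizers of $v$ in $\mathrm{Aut}(T)$, $\Gamma$,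 $\Lambda$ (acting via $\imath$, $\rho$), and put $\Sigma_v=\Phi^{-1}(\mathrm{Stab}(v))$. Suppose that (a) for $i=1,2$, $\Gamma_i$ is coupling rigid with respect to a pair $(G_i,\pi_i)$, where $G_i$ is a standard Borel group, $\pi_i\colon\Gamma_i\to G_i$ is a homomorphism with finite kernel, and the action of $\pi_i(\Gamma_i)$ on $G_i$ by left multiplication admits a Borel fundamental domain; (b) for $i=1,2$ and each $v\in V_i(T)$ there are $\gamma_v\in\Gamma$ with $\gamma_v v=\Gamma_i\in\Gamma/\Gamma_i$ (so that $\gamma_v\Gamma_v\gamma_v^{-1}=\Gamma_i$), a homomorphism $\rho_v\colon\Lambda_v\to G_i$ and an almost $(\Gamma_v\times\Lambda_v)$-equivariant Borel map $\Phi_v\colon\Sigma_v\to(G_i,\pi_v,\rho_v)$, where $\pi_v(\gamma)=\pi_i(\gamma_v\gamma\gamma_v^{-1})$, such that the measure $(\Phi_v)_*(m|_{\Sigma_v})$ on $G_i$ is atomic. **Conditions.** $(\mathsf V)_i$: there is $c>0$ such that $\dfrac{[\Delta:\pi_i(\Gamma_i)\cap\Delta]}{[\pi_i(\Gamma_i):\pi_i(\Gamma_i)\cap\Delta]}\le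 c$ for every subgroup $\Delta<G_i$ with $\Delta\asymp\pi_i(\Gamma_i)$. $(\mathsf E)_i$: there is $d>0$ such that $\dfrac{[\Delta_0:\pi_i(A_i)\cap\Delta_0]}{[\pi_i(A_i):\pi_i(A_i)\cap\Delta_0]}\le d$ for every subgroup $\Delta<G_i$ with $\Delta\asymp\pi_i(\Gamma_i)$ and every subgroup $\Delta_0<\Delta$ with $\Delta_0\asymp\pi_i(A_i)$. $(\mathsf F)_i$: for every subgroup $\Delta<G_i$ with $\Delta\asymp\pi_i(\Gamma_i)$ and every subgroup $\Delta_0<\Delta$ with $\Delta_0\asymp\pi_i(A_i)$, the group $\Delta_0$ has no non-trivial finite normal subgroup. $(\mathsf B)$: there is a finite bound for the cardinalities of the finite subgroups of $\Lambda$. **Proposition 5.13.** In this setting, with $\Lambda$ acting on $T$ via $\rho$, the following hold. 1. For each $i=1,2$: if $(\mathsf E)_i$ holds, then for every $v\in V_i(T)$ the action of $\Lambda_v$ on the link $\mathrm{Lk}(v)$ (the set of vertices adjacent to $v$) has only finitely many orbits. 2. For each $i=1,2$: if $(\mathsf V)_i$ and $(\mathsf B)$ hold, then the action of $\Lambda$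 on $V_i(T)$ has only finitely many orbits. 3. If $(\mathsf V)_1$, $(\mathsf V)_2$, $(\mathsf E)_1$, $(\mathsf E)_2$ and $(\mathsf B)$ hold, then the action of $\Lambda$ on $T$ is cocompact, i.e. it has only finitely many orbits of vertices and of edges. 4. If, for each $i=1,2$, $A_i\ne\Gamma_i$ and $\mathrm{LQN}_{\Gamma_i}(A_i)=A_i$, then $(\mathsf B)$ can be replaced in both 2 and 3 by the condition that both $(\mathsf F)_1$ and $(\mathsf F)_2$ hold. -/

import Mathlib

open MeasureTheory Monoid

noncomputable section

namespace AmalgamME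

/-! ### The amalgamated free product and its Bass-Serre tree

`Γ 0`, `Γ 1` are the two factors, `φ i : A →* Γ i` the two (injective) inclusions of the
amalgamated subgroup, so that `A_i` is `(φ i).range` and the amalgamated free product
`⟨Γ 0, Γ 1 | A_0 ≃ A_1⟩` is `Monoid.PushoutI φ`. The index `0 : Fin 2` is the first factor and
`1 : Fin 2` the second one. -/

section Tree

variable {A : Type*} {Γ : Fin 2 → Type*} [Group A] [∀ i, Group (Γ i)] (φ : ∀ i, A →* Γ i)

/-- The image of the factor `Γ i` in the amalgamated free product. -/
abbrev factor (i : Fin 2) : Subgroup (PushoutI φ) := (PushoutI.of (φ := φ) i).range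

/-- The vertex set `V(T)`: the disjoint union of the coset spaces of the two factors. -/
abbrev Vertex : Type _ := Σ i : Fin 2, PushoutI φ ⧸ factor φ i

/-- The vertex `γ Γ_i`. -/
def coset (i : Fin 2) (γ : PushoutI φ) : Vertex φ := ⟨i, (γ : PushoutI φ ⧸ factor φ i)⟩

/-- The set `V_i(T)` of cosets of the factor `Γ i`. -/
def vertexClass (i : Fin 2) : Set (Vertex φ) := {v | v.1 = i}

/-- `OrientedEdge φ u v`: for some `γ`, the vertices `u = γ Γ_0` and `v = γ Γ_1` are the origin and
the terminal of the edge `γ A`. -/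
def OrientedEdge (u v : Vertex φ) : Prop :=
  ∃ γ : PushoutI φ, u = coset φ 0 γ ∧ v = coset φ 1 γ

theorem OrientedEdge.ne {u v : Vertex φ} (h : OrientedEdge φ u v) : u ≠ v := by
  obtain ⟨γ, rfl, rfl⟩ := h
  intro h
  exact absurd (congrArg Sigma.fst h) (by simp [coset])

/-- The Bass-Serre tree `T`: each `γ` gives an edge between `γ Γ_0` and `γ Γ_1`. -/
def bassSerreTree : SimpleGraph (Vertex φ) where
  Adj u v := OrientedEdge φ u v ∨ OrientedEdge φ v u
  symm := ⟨fun _ _ h => h.symm⟩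
  loopless := ⟨fun _ h => h.elim (fun h => h.ne φ rfl) (fun h => h.ne φ rfl)⟩

/-- The simplicial automorphisms of `T` that preserve the orientation, as a subgroup of the group of
all simplicial automorphisms. -/
def orientedAut : Subgroup (bassSerreTree φ ≃g bassSerreTree φ) where
  carrier := {f | ∀ u v, OrientedEdge φ (f u) (f v) ↔ OrientedEdge φ u v}
  one_mem' := fun _ _ => Iff.rfl
  mul_mem' := fun {f g} hf hg u v => (hf (g u) (g v)).trans (hg u v)
  inv_mem' := fun {f} hf u v => by
    have h := hf (f⁻¹ u) (f⁻¹ v)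
    rw [RelIso.apply_inv_self, RelIso.apply_inv_self] at h
    exact h.symm

/-- The group `Aut(T)`. -/
abbrev AutT : Type _ := ↥(orientedAut φ)

/-- The topology of pointwise convergence on `Aut(T)`, the vertex set being discrete. -/
instance : TopologicalSpace (AutT φ) :=
  TopologicalSpace.induced (fun (f : AutT φ) (v : Vertex φ) => f.1 v)
    (@Pi.topologicalSpace (Vertex φ) (fun _ => Vertex φ) (fun _ => ⊥))

/-- The Borel structure of the pointwise convergence topology on `Aut(T)`. -/
instance : MeasurableSpace (AutT φ) := borel (AutT φ)

theorem orientedEdge_smul (γ : PushoutI φ) (u v : Vertex φ) :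
    OrientedEdge φ (γ • u) (γ • v) ↔ OrientedEdge φ u v := by
  have key : ∀ (δ : PushoutI φ) (a b : Vertex φ),
      OrientedEdge φ a b → OrientedEdge φ (δ • a) (δ • b) := by
    rintro δ a b ⟨ε, rfl, rfl⟩
    exact ⟨δ * ε, rfl, rfl⟩
  exact ⟨fun h => by simpa using key γ⁻¹ _ _ h, key γ u v⟩

/-- The homomorphism `Γ → Aut(T)` given by left multiplication on cosets. -/
def treeAction : PushoutI φ →* AutT φ where
  toFun γ := ⟨⟨(MulAction.toPerm γ : Equiv.Perm (Vertex φ)), by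
      intro u v
      exact or_congr (orientedEdge_smul φ γ u v) (orientedEdge_smul φ γ v u)⟩,
    fun u v => orientedEdge_smul φ γ u v⟩
  map_one' := by
    apply Subtype.ext
    ext v : 1
    exact one_smul (PushoutI φ) v
  map_mul' γ δ := by
    apply Subtype.ext
    ext v : 1
    exact mul_smul γ δ v

/-- `Stab(v)`, the stabilizer of a vertex `v` in `Aut(T)`. -/
def vertexStab (v : Vertex φ) : Subgroup (AutT φ) := MulAction.stabilizer (AutT φ) v

/-- `Γ_v`, the stabilizer of `v` in the amalgamated free product. -/
def amalgamStab (v : Vertex φ) : Subgroup (PushoutI φ) := (vertexStab φ v).comap (treeAction φ)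

/-- `Λ_v`, the stabilizer of `v` in a group `Λ` acting on `T` through `ρ`. -/
def actingStab {Λ : Type*} [Group Λ] (ρ : Λ →* AutT φ) (v : Vertex φ) : Subgroup Λ :=
  (vertexStab φ v).comap ρ

/-- The subset `Σ_v = Φ⁻¹(Stab(v))` of the coupling space. -/
def smallCoupling {S : Type*} (Φ : S → AutT φ) (v : Vertex φ) : Set S :=
  Φ ⁻¹' (vertexStab φ v : Set (AutT φ))

variable {φ}

/-- If `γ_v v` is the base vertex `Γ_i`, then `γ_v Γ_v γ_v⁻¹ = Γ_i`. -/
theorem map_conj_amalgamStab {v : Vertex φ} {γv : PushoutI φ} (h : γv • v = coset φ v.1 1) :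
    (amalgamStab φ v).map (MulAut.conj γv).toMonoidHom = factor φ v.1 := by
  obtain ⟨i, q⟩ := v
  have hq : q = γv⁻¹ • ((1 : PushoutI φ) : PushoutI φ ⧸ factor φ i) := by
    have h' : γv • q = ((1 : PushoutI φ) : PushoutI φ ⧸ factor φ i) := by
      simpa [coset, Sigma.smul_mk] using h
    rw [← h', inv_smul_smul]
  have hmem : ∀ γ : PushoutI φ, γ ∈ amalgamStab φ ⟨i, q⟩ ↔ γv * γ * γv⁻¹ ∈ factor φ i := by
    intro γ
    have h1 : γ ∈ amalgamStab φ ⟨i, q⟩ ↔ γ • q = q := by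
      change (⟨i, γ • q⟩ : Vertex φ) = ⟨i, q⟩ ↔ _
      simp
    rw [h1, hq, smul_smul, eq_inv_smul_iff, smul_smul, eq_comm]
    change ((1 : PushoutI φ) : PushoutI φ ⧸ factor φ i) =
      ((γv * (γ * γv⁻¹) * 1 : PushoutI φ) : PushoutI φ ⧸ factor φ i) ↔ _
    rw [QuotientGroup.eq]
    simp [mul_assoc]
  ext δ
  rw [Subgroup.mem_map_equiv]
  rw [hmem]
  simp [mul_assoc]

/-- The homomorphism `π_v : Γ_v → G_i`, `π_v(γ) = π_i(γ_v γ γ_v⁻¹)`, for `v ∈ V_i(T)`. -/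
def vertexHom (hφ : ∀ i, Function.Injective (φ i)) {G : Fin 2 → Type*} [∀ i, Group (G i)]
    (π : ∀ i, Γ i →* G i) (v : Vertex φ) (γv : PushoutI φ) (h : γv • v = coset φ v.1 1) :
    amalgamStab φ v →* G v.1 :=
  (π v.1).comp <|
    (MonoidHom.ofInjective (PushoutI.of_injective hφ v.1)).symm.toMonoidHom.comp <|
      ((MulAut.conj γv).toMonoidHom.comp (amalgamStab φ v).subtype).codRestrict (factor φ v.1)
        fun γ => by
          rw [← map_conj_amalgamStab h]
          exact Subgroup.mem_map_of_mem _ γ.2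

theorem of_vertexHom_arg (hφ : ∀ i, Function.Injective (φ i)) {G : Fin 2 → Type*}
    [∀ i, Group (G i)] (π : ∀ i, Γ i →* G i) (v : Vertex φ) (γv : PushoutI φ)
    (h : γv • v = coset φ v.1 1) (γ : amalgamStab φ v) (a : Γ v.1)
    (ha : PushoutI.of (φ := φ) v.1 a = γv * γ * γv⁻¹) : vertexHom hφ π v γv h γ = π v.1 a := by
  unfold vertexHom
  simp only [MonoidHom.comp_apply]
  congr 1
  apply (MulEquiv.symm_apply_eq _).2
  exact Subtype.ext ha.symm

end Tree

/-! ### Couplings and coupling rigidity -/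

/-- `(S, m)` with an action of `Γ × Λ` is a coupling of the groups `Γ` and `Λ`: the measure is
non-zero and `σ`-finite, the action is Borel and preserves the measure, and there are Borel
fundamental domains of finite measure for each of the two groups
(up to null sets, `S` is the disjoint union of the translates of `Y` under `Γ`, and of the
translates of `X` under `Λ`). -/
structure IsCoupling (Γ Λ : Type*) [Group Γ] [Group Λ] {S : Type*} [MeasurableSpace S]
    [MulAction (Γ × Λ) S] (m : Measure S) : Prop where
  sigmaFinite : SigmaFinite m
  ne_zero : m ≠ 0
  measurePreserving : ∀ g : Γ × Λ, MeasurePreserving (fun x : S => g • x) m m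
  exists_left : ∃ Y : Set S, MeasurableSet Y ∧
    IsFundamentalDomain (MonoidHom.inl Γ Λ).range Y m ∧ m Y < ⊤
  exists_right : ∃ X : Set S, MeasurableSet X ∧
    IsFundamentalDomain (MonoidHom.inr Γ Λ).range X m ∧ m X < ⊤

/-- `Φ` is almost `(Γ × Λ)`-equivariant into `(G, π, ρ)`, the space `G` with the action
`(γ, λ) g = π(γ) g ρ(λ)⁻¹`. -/
def AlmostEquivariant {Γ Λ S G : Type*} [Group Γ] [Group Λ] [MeasurableSpace S]
    [MulAction (Γ × Λ) S] [Group G] (m : Measure S) (π : Γ →* G) (ρ : Λ →* G) (Φ : S → G) : Prop :=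
  ∀ (γ : Γ) (l : Λ), ∀ᵐ x ∂m, Φ ((γ, l) • x) = π γ * Φ x * (ρ l)⁻¹

/-- `Γ` is coupling rigid with respect to `(G, π)`. Every standard Borel space is isomorphic to one
in `Type`, so that it is enough to quantify over the latter. -/
structure CouplingRigid {Γ G : Type*} [Group Γ] [Group G] [MeasurableSpace G] (π : Γ →* G) :
    Prop where
  exists_map : ∀ (S : Type) [MeasurableSpace S] [StandardBorelSpace S] [MulAction (Γ × Γ) S]
    (m : Measure S), IsCoupling Γ Γ m →
      ∃ Φ : S → G, Measurable Φ ∧ AlmostEquivariant m π π Φ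
  eq_dirac : ∀ μ : Measure G, IsProbabilityMeasure μ →
    (∀ γ : Γ, μ.map (fun g => π γ * g * (π γ)⁻¹) = μ) → μ = Measure.dirac 1

/-- The action of `π(Γ)` on `G` by left multiplication admits a Borel fundamental domain. -/
def HasBorelFundamentalDomain {Γ G : Type*} [Group Γ] [Group G] [MeasurableSpace G]
    (π : Γ →* G) : Prop :=
  ∃ D : Set G, MeasurableSet D ∧ ∀ g : G, ∃! h : π.range, (h : G) * g ∈ D

/-- A measure is atomic if some countable set has a null complement. -/
def IsAtomicMeasure {G : Type*} [MeasurableSpace G] (μ : Measure G) : Prop :=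
  ∃ C : Set G, C.Countable ∧ μ Cᶜ = 0

/-- For the vertex `v ∈ V_i(T)` there are a homomorphism `ρ_v : Λ_v → G_i` and an almost
`(Γ_v × Λ_v)`-equivariant Borel map `Φ_v : Σ_v → (G_i, π_v, ρ_v)` (written as the restriction of a
Borel map on the whole space) such that the image under `Φ_v` of the restriction of `m` to `Σ_v`
is atomic. -/
def HasAtomicVertexImage {A : Type*} {Γ : Fin 2 → Type*} [Group A] [∀ i, Group (Γ i)]
    {φ : ∀ i, A →* Γ i} (hφ : ∀ i, Function.Injective (φ i))
    {Λ S : Type*} [Group Λ] [MeasurableSpace S] [MulAction (PushoutI φ × Λ) S] (m : Measure S)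
    (ρ : Λ →* AutT φ) (Φ : S → AutT φ)
    {G : Fin 2 → Type*} [∀ i, Group (G i)] [∀ i, MeasurableSpace (G i)]
    (π : ∀ i, Γ i →* G i) (v : Vertex φ) : Prop :=
  ∃ (γv : PushoutI φ) (hγv : γv • v = coset φ v.1 1)
    (ρv : actingStab φ ρ v →* G v.1) (Φv : S → G v.1),
    Measurable Φv ∧
    (∀ (γ : amalgamStab φ v) (l : actingStab φ ρ v), ∀ᵐ x ∂(m.restrict (smallCoupling φ Φ v)),
      Φv (((γ : PushoutI φ), (l : Λ)) • x) = vertexHom hφ π v γv hγv γ * Φv x * (ρv l)⁻¹) ∧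
    IsAtomicMeasure ((m.restrict (smallCoupling φ Φ v)).map Φv)

/-! ### The conditions on subgroups

`Subgroup.Commensurable Δ₁ Δ₂` says that `Δ₁ ∩ Δ₂` has finite index in both `Δ₁` and `Δ₂`, and
`H.relIndex K` is the index `[K : H ∩ K]`. -/

/-- Condition (V) for `(Γ, (G, π))`. -/
def ConditionV {Γ G : Type*} [Group Γ] [Group G] (π : Γ →* G) : Prop :=
  ∃ c : ℝ, 0 < c ∧ ∀ Δ : Subgroup G, Δ.Commensurable π.range →
    (π.range.relIndex Δ : ℝ) / (Δ.relIndex π.range : ℝ) ≤ c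

/-- Condition (E) for `(Γ, A, (G, π))`. -/
def ConditionE {Γ G : Type*} [Group Γ] [Group G] (A : Subgroup Γ) (π : Γ →* G) : Prop :=
  ∃ d : ℝ, 0 < d ∧ ∀ Δ : Subgroup G, Δ.Commensurable π.range →
    ∀ Δ₀ : Subgroup G, Δ₀ ≤ Δ → Δ₀.Commensurable (A.map π) →
      ((A.map π).relIndex Δ₀ : ℝ) / (Δ₀.relIndex (A.map π) : ℝ) ≤ d

/-- Condition (F) for `(Γ, A, (G, π))`. -/
def ConditionF {Γ G : Type*} [Group Γ] [Group G] (A : Subgroup Γ) (π : Γ →* G) : Prop :=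
  ∀ Δ : Subgroup G, Δ.Commensurable π.range →
    ∀ Δ₀ : Subgroup G, Δ₀ ≤ Δ → Δ₀.Commensurable (A.map π) →
      ∀ N : Subgroup Δ₀, N.Normal → Finite N → N = ⊥

/-- Condition (B): the cardinalities of the finite subgroups of `Λ` are bounded. -/
def ConditionB (Λ : Type*) [Group Λ] : Prop :=
  ∃ C : ℕ, ∀ H : Subgroup Λ, Finite H → Nat.card H ≤ C

/-- The left quasi-normalizer of `H` in `G`: the set of all `g` with `[H : g H g⁻¹ ∩ H] < ∞`. -/
def leftQuasiNormalizer {G : Type*} [Group G] (H : Subgroup G) : Set G :=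
  {g | (H.map (MulAut.conj g).toMonoidHom).relIndex H ≠ 0}

/-! ### Finiteness of orbits -/

section Orbits

variable {A : Type*} {Γ : Fin 2 → Type*} [Group A] [∀ i, Group (Γ i)] {φ : ∀ i, A →* Γ i}
  {Λ : Type*} [Group Λ]

/-- The subgroup `H` of `Λ`, acting on `T` through `ρ`, has only finitely many orbits in the
set `U` of vertices. -/
def FinitelyManyOrbits (ρ : Λ →* AutT φ) (H : Subgroup Λ) (U : Set (Vertex φ)) : Prop :=
  {O : Set (Vertex φ) | ∃ u ∈ U, O = {w | ∃ l ∈ H, w = ρ l • u}}.Finite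

/-- The action of `Λ` on `T` through `ρ` is cocompact: the quotient graph is finite, that is, there
are finitely many orbits of vertices and finitely many orbits of edges. -/
def IsCocompact (ρ : Λ →* AutT φ) : Prop :=
  FinitelyManyOrbits ρ ⊤ Set.univ ∧
  {O : Set (Sym2 (Vertex φ)) | ∃ e ∈ (bassSerreTree φ).edgeSet,
    O = {e' | ∃ l : Λ, e' = e.map (fun v => ρ l • v)}}.Finite

end Orbits

end AmalgamME

end

open AmalgamME

/-!
All four claims compare covolumes. Let `κ` and `ℓ` be the covolumes of the amalgam `Γ` and of `Λ` on
the coupling. For a vertex `v`, the set `Σ_v` of the points whose image under `Φ` fixes `v` carries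
actions of the stabilizers `Γ_v` and `Λ_v`. As `Γ` is transitive on each class of vertices, `Γ_v`
has covolume `κ` on `Σ_v`. The covolumes of the groups `Λ_v`, for `v` running through
representatives of the orbits of `Λ` on a class, add up to at most `ℓ`
(`IsSubcoupling.fix`, `IsSubcoupling.finite_orbits`). Hence there are finitely many orbits as soon
as the covolume of `Λ_v` is bounded away from zero. The same holds for the orbits of `Λ_v` on the
link of `v`, the set `Σ_v` being replaced by the sets of points that also fix an edge at `v`.

The bound comes from the atoms of the equivariant map `Φ_v` into `G_i`. If the fibre over `g` is not
null, then over the double coset of `g` the covolume of `Γ_v` times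
`|ker π_v| [π_v(Γ_v) : π_v(Γ_v) ∩ D]` is the covolume of `Λ_v` times `|ker ρ_v| [D : π_v(Γ_v) ∩ D]`,
where `D = g ρ_v(Λ_v) g⁻¹`, and all these numbers are finite (`atom_comparison`). Summing over the
double cosets (`covolume_le`), condition (V) bounds the quotient of the covolumes up to the order of
`ker ρ_v`, and condition (E) does so for the edge groups. For the link of a single vertex the finite
group `ker ρ_v` is fixed. For the orbits of vertices its order has to be bounded for all `v`, which
is immediate from (B).

In place of (B), suppose that (F) holds and `A` is its own left quasi-normalizer in both factors.
Then the stabilizer in `Γ` of an edge at `v` has infinite orbits on the rest of the link of `v`, and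
by another comparison of covolumes so has the stabilizer in `Λ` (`IsSubcoupling.infinite_orbit`).
The finite normal subgroup `ker ρ_v` of `Λ_v` therefore fixes the link of `v`
(`IsTreeCoupling.le_actingStab_of_adj`). For a neighbour `u` of `v` it is thus a finite normal
subgroup of the edge group, so (F) at `u` puts it into `ker ρ_u`. By symmetry and connectedness of
the tree all the groups `ker ρ_v` coincide (`IsTreeCoupling.ker_eq`).

Covolumes are computed by weights (`IsWeight`), non-negative functions whose sum over almost every
orbit is one. Unlike fundamental domains they pass to stabilizers of fibres by plain summation.
-/

open MeasureTheory Monoid ENNReal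

namespace AmalgamME

/-! ### Weights and covolumes -/

section Weights

/-- Each element of a group is uniquely the product of the chosen representative of its coset and
an element of the subgroup. -/
noncomputable def outMulEquiv {H : Type*} [Group H] (s : Subgroup H) : (H ⧸ s) × s ≃ H where
  toFun p := p.1.out * p.2
  invFun h := (h, ⟨(h : H ⧸ s).out⁻¹ * h, QuotientGroup.eq.1 (QuotientGroup.out_eq' _)⟩)
  left_inv := by
    rintro ⟨q, h⟩
    have h1 : ((q.out * h : H) : H ⧸ s) = q := by
      rw [QuotientGroup.mk_mul_of_mem _ h.2, QuotientGroup.out_eq']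
    refine Prod.ext h1 (Subtype.ext ?_)
    simp only [h1, inv_mul_cancel_left]
  right_inv h := mul_inv_cancel_left _ _

variable {H S X : Type*} [Group H] [MulAction H S] [MeasurableSpace S]

/-- A weight for the action of `H` on the set `E`: a fractional fundamental domain, that is, a
non-negative Borel function whose sum over almost every `H`-orbit in `E` is one. -/
structure IsWeight (H : Type*) {S : Type*} [Group H] [MulAction H S] [MeasurableSpace S]
    (m : Measure S) (E : Set S) (w : S → ℝ≥0∞) : Prop where
  measurable : Measurable w
  sum_eq : ∀ᵐ x ∂m, x ∈ E → ∑' h : H, w (h • x) = 1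

/-- The set `E` is invariant under each element of `H` up to null sets. -/
def AEInvariant (H : Type*) {S : Type*} [Group H] [MulAction H S] [MeasurableSpace S]
    (m : Measure S) (E : Set S) : Prop :=
  ∀ h : H, ∀ᵐ x ∂m, (h • x ∈ E ↔ x ∈ E)

variable {m : Measure S}

theorem IsWeight.mono {E F : Set S} {w : S → ℝ≥0∞} (hw : IsWeight H m E w) (h : F ⊆ E) :
    IsWeight H m F w :=
  ⟨hw.measurable, hw.sum_eq.mono fun _ hx hxF => hx (h hxF)⟩

theorem IsWeight.congr_equiv {H' : Type*} [Group H'] [MulAction H' S] {E : Set S} {w : S → ℝ≥0∞}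
    (hw : IsWeight H m E w) (e : H' ≃ H) (he : ∀ h (x : S), e h • x = h • x) :
    IsWeight H' m E w := by
  refine ⟨hw.measurable, hw.sum_eq.mono fun x hx hxE => ?_⟩
  rw [← hx hxE, ← e.tsum_eq]
  exact tsum_congr fun h => by rw [he]

variable [MeasurableConstSMul H S]

theorem setLIntegral_mul_tsum [Countable H] {E : Set S} {f w : S → ℝ≥0∞} (hE : MeasurableSet E)
    (hf : Measurable f) (hw : IsWeight H m E w) :
    ∫⁻ x in E, f x ∂m = ∑' h : H, ∫⁻ x in E, f x * w (h • x) ∂m := by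
  have hm : ∀ h : H, AEMeasurable (fun x => f x * w (h • x)) (m.restrict E) := fun h =>
    (hf.mul (hw.measurable.comp (measurable_const_smul h))).aemeasurable
  rw [← lintegral_tsum hm]
  refine lintegral_congr_ae ((ae_restrict_iff' hE).2 ?_)
  filter_upwards [hw.sum_eq] with x hx hxE
  rw [ENNReal.tsum_mul_left, hx hxE, mul_one]

variable [SMulInvariantMeasure H S m]

theorem ae_smul (h : H) {p : S → Prop} (hp : ∀ᵐ x ∂m, p x) : ∀ᵐ x ∂m, p (h • x) :=
  (measurePreserving_smul h m).quasiMeasurePreserving.ae hp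

/-- Change of variable along `h` between two sets that correspond to each other almost
everywhere. -/
theorem setLIntegral_smul (h : H) {E F : Set S} (hF : MeasurableSet F)
    (hEF : ∀ᵐ x ∂m, (h • x ∈ F ↔ x ∈ E)) {f : S → ℝ≥0∞} (hf : Measurable f) :
    ∫⁻ x in E, f (h • x) ∂m = ∫⁻ x in F, f x ∂m := by
  have h0 : E =ᵐ[m] (fun x => h • x) ⁻¹' F := by
    filter_upwards [hEF] with x hx
    exact propext hx.symm
  rw [Measure.restrict_congr_set h0]
  exact (measurePreserving_smul h m).setLIntegral_comp_preimage hF hf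

theorem measure_eq_of_smul (h : H) {E F : Set S} (hF : MeasurableSet F)
    (hEF : ∀ᵐ x ∂m, (h • x ∈ F ↔ x ∈ E)) : m E = m F := by
  simpa using setLIntegral_smul (m := m) h hF hEF (f := fun _ => 1) measurable_const

variable [Countable H]

/-- The covolume does not depend on the weight used to compute it. -/
theorem IsWeight.setLIntegral_eq {E : Set S} {w w' : S → ℝ≥0∞} (hE : MeasurableSet E)
    (hinv : AEInvariant H m E) (hw : IsWeight H m E w) (hw' : IsWeight H m E w') :
    ∫⁻ x in E, w x ∂m = ∫⁻ x in E, w' x ∂m := by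
  rw [setLIntegral_mul_tsum hE hw.measurable hw', setLIntegral_mul_tsum hE hw'.measurable hw,
    ← (Equiv.inv H).tsum_eq]
  refine tsum_congr fun h => ?_
  have := setLIntegral_smul (m := m) h hE (hinv h) (f := fun x => w x * w' (h⁻¹ • x))
    (hw.measurable.mul (hw'.measurable.comp (measurable_const_smul h⁻¹)))
  simp only [inv_smul_smul] at this
  rw [Equiv.inv_apply, ← this]
  simp only [mul_comm]

theorem IsWeight.measure_eq {E : Set S} {w : S → ℝ≥0∞} (hE : MeasurableSet E)
    (hinv : AEInvariant H m E) (hw : IsWeight H m E w) :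
    m E = ENat.card H * ∫⁻ x in E, w x ∂m := by
  have h1 := setLIntegral_mul_tsum hE (f := fun _ => 1) measurable_const hw
  simp only [one_mul, setLIntegral_one] at h1
  rw [h1, ← ENNReal.tsum_const]
  exact tsum_congr fun h => setLIntegral_smul h hE (hinv h) hw.measurable

variable [MulAction H X]

/-- Suppose that `Ψ` is an almost equivariant map to an `H`-set. A weight for `H` on `E` induces a
weight for the stabilizer of `y` on the fibre over `y`: sum the given weight over representatives
of the cosets of the stabilizer. The covolume of the fibre is that of the preimage of the orbit. -/
theorem IsWeight.exists_fiber {E : Set S} {w : S → ℝ≥0∞} {Ψ : S → X} (y : X)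
    (hinv : AEInvariant H m E) (hw : IsWeight H m E w)
    (hΨ : ∀ h : H, ∀ᵐ x ∂m, x ∈ E → Ψ (h • x) = h • Ψ x)
    (hmeas : ∀ h : H, MeasurableSet (E ∩ Ψ ⁻¹' {h • y})) :
    ∃ w' : S → ℝ≥0∞, IsWeight (MulAction.stabilizer H y) m (E ∩ Ψ ⁻¹' {y}) w' ∧
      ∫⁻ x in E ∩ Ψ ⁻¹' {y}, w' x ∂m = ∫⁻ x in E ∩ Ψ ⁻¹' MulAction.orbit H y, w x ∂m := by
  have : Countable (H ⧸ MulAction.stabilizer H y) := Quotient.countable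
  have hwm : ∀ h : H, Measurable fun x => w (h • x) := fun h =>
    hw.measurable.comp (measurable_const_smul h)
  refine ⟨fun x => ∑' q : H ⧸ MulAction.stabilizer H y, w (q.out • x), ⟨?_, ?_⟩, ?_⟩
  · exact Measurable.tsum fun q => hwm _
  · filter_upwards [hw.sum_eq] with x hx hxE
    rw [← hx hxE.1, ← (outMulEquiv (MulAction.stabilizer H y)).tsum_eq,
      ENNReal.tsum_prod', ENNReal.tsum_comm]
    refine tsum_congr fun q => tsum_congr fun h => ?_
    rw [Subgroup.smul_def, smul_smul]
    rfl
  · have hset : E ∩ Ψ ⁻¹' MulAction.orbit H y =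
        ⋃ q : H ⧸ MulAction.stabilizer H y, E ∩ Ψ ⁻¹' {q.out • y} := by
      ext x
      simp only [Set.mem_inter_iff, Set.mem_preimage, Set.mem_iUnion, Set.mem_singleton_iff,
        exists_and_left, MulAction.mem_orbit_iff]
      refine and_congr_right fun _ => ⟨?_, fun ⟨q, hq⟩ => ⟨q.out, hq.symm⟩⟩
      rintro ⟨h, hh⟩
      refine ⟨(h : H ⧸ MulAction.stabilizer H y), ?_⟩
      obtain ⟨s, hs⟩ := QuotientGroup.mk_out_eq_mul (MulAction.stabilizer H y) h
      rw [hs, ← hh, mul_smul, s.2]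
    have hdisj : Pairwise (Function.onFun Disjoint
        fun q : H ⧸ MulAction.stabilizer H y => E ∩ Ψ ⁻¹' {q.out • y}) := by
      intro q q' hq
      refine Set.disjoint_left.2 fun x hx hx' => hq ?_
      have h1 : q.out • y = q'.out • y := hx.2.symm.trans hx'.2
      rw [← QuotientGroup.out_eq' q, ← QuotientGroup.out_eq' q', QuotientGroup.eq,
        MulAction.mem_stabilizer_iff, mul_smul, ← h1, inv_smul_smul]
    rw [hset, lintegral_iUnion (fun q => hmeas _) hdisj,
      lintegral_tsum fun q => (hwm _).aemeasurable]
    refine tsum_congr fun q => ?_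
    refine setLIntegral_smul _ (hmeas _) ?_ hw.measurable
    filter_upwards [hinv q.out, hΨ q.out] with x hx1 hx2
    simp only [Set.mem_inter_iff, hx1, Set.mem_preimage, Set.mem_singleton_iff]
    refine and_congr_right fun hxE => ?_
    rw [hx2 hxE, smul_left_cancel_iff]

theorem IsWeight.measure_fiber {E : Set S} {w : S → ℝ≥0∞} {Ψ : S → X} (y : X)
    (hinv : AEInvariant H m E) (hw : IsWeight H m E w)
    (hΨ : ∀ h : H, ∀ᵐ x ∂m, x ∈ E → Ψ (h • x) = h • Ψ x)
    (hmeas : ∀ h : H, MeasurableSet (E ∩ Ψ ⁻¹' {h • y})) :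
    m (E ∩ Ψ ⁻¹' {y}) = ENat.card (MulAction.stabilizer H y) *
      ∫⁻ x in E ∩ Ψ ⁻¹' MulAction.orbit H y, w x ∂m := by
  obtain ⟨w', hw', h⟩ := hw.exists_fiber y hinv hΨ hmeas
  have hm1 := hmeas 1
  rw [one_smul] at hm1
  rw [← h]
  refine hw'.measure_eq hm1 fun s => ?_
  filter_upwards [hinv s, hΨ s] with x hx1 hx2
  rw [Subgroup.smul_def]
  simp only [Set.mem_inter_iff, hx1, Set.mem_preimage, Set.mem_singleton_iff]
  refine and_congr_right fun hxE => ?_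
  rw [hx2 hxE, smul_eq_iff_eq_inv_smul, MulAction.mem_stabilizer_iff.1 (inv_mem s.2)]

end Weights

/-! ### Covolumes and atoms of equivariant maps into a group -/

section Index

theorem card_quotient_subgroupOf {G : Type*} [Group G] (A B : Subgroup G) (h : A.relIndex B ≠ 0) :
    (ENat.card (B ⧸ A.subgroupOf B) : ℝ≥0∞) = A.relIndex B := by
  have : Finite (B ⧸ A.subgroupOf B) := Nat.finite_of_card_ne_zero h
  rw [ENat.card_eq_coe_natCard]
  rfl

theorem relIndex_ne_zero_of_card {G : Type*} [Group G] (A B : Subgroup G)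
    (h : (ENat.card (B ⧸ A.subgroupOf B) : ℝ≥0∞) ≠ ∞) : A.relIndex B ≠ 0 := by
  have : Finite (B ⧸ A.subgroupOf B) := by
    by_contra hc
    rw [not_finite_iff_infinite] at hc
    simp [ENat.card_eq_top_of_infinite] at h
  exact Subgroup.index_ne_zero_of_finite (H := A.subgroupOf B)

variable {H K L S G : Type*} [Group H] [MulAction H S] [Group K] [MulAction K S] [Group L]
  [MulAction L S] [MeasurableSpace S] [Group G] [MeasurableSpace G] [MeasurableSingletonClass G]
  {m : Measure S}

section OneSided

variable [MeasurableConstSMul H S] [SMulInvariantMeasure H S m] [Countable H]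
  {E : Set S} {w : S → ℝ≥0∞} {α : H →* G} {Ψ : S → G}

/-- The fibre over `g` of an almost equivariant map into `G` is invariant under the kernel, and it
meets every orbit over the coset `α(H) g`. -/
theorem IsWeight.measure_fiber_eq_card_ker (g : G) (hE : MeasurableSet E) (hΨm : Measurable Ψ)
    (hinv : AEInvariant H m E) (hw : IsWeight H m E w)
    (hΨ : ∀ h : H, ∀ᵐ x ∂m, x ∈ E → Ψ (h • x) = α h * Ψ x) :
    m (E ∩ Ψ ⁻¹' {g}) =
      ENat.card α.ker * ∫⁻ x in E ∩ Ψ ⁻¹' Set.range (fun h => α h * g), w x ∂m := by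
  let _ : MulAction H G := MulAction.compHom G α
  have hsm : ∀ (h : H) (z : G), h • z = α h * z := fun _ _ => rfl
  have h1 := hw.measure_fiber (X := G) g hinv hΨ fun h =>
    hE.inter (hΨm (measurableSet_singleton _))
  have h2 : MulAction.stabilizer H g = α.ker := by
    ext h
    rw [MulAction.mem_stabilizer_iff, hsm, mul_eq_right, MonoidHom.mem_ker]
  rw [h2] at h1
  exact h1

/-- The preimage of `α(H) B g` consists of `[B : α(H) ∩ B]` pieces of the same covolume. -/
theorem IsWeight.card_ker_mul_doubleCoset (g : G) (hE : MeasurableSet E) (hΨm : Measurable Ψ)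
    (hinv : AEInvariant H m E) (hw : IsWeight H m E w)
    (hΨ : ∀ h : H, ∀ᵐ x ∂m, x ∈ E → Ψ (h • x) = α h * Ψ x) (B : Subgroup G) [Countable B]
    (hB : ∀ b ∈ B, m (E ∩ Ψ ⁻¹' {b * g}) = m (E ∩ Ψ ⁻¹' {g})) :
    ENat.card α.ker * ∫⁻ x in E ∩ Ψ ⁻¹' {z | ∃ h, ∃ b ∈ B, z = α h * b * g}, w x ∂m =
      ENat.card (B ⧸ α.range.subgroupOf B) * m (E ∩ Ψ ⁻¹' {g}) := by
  have : Countable (B ⧸ α.range.subgroupOf B) := Quotient.countable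
  have hset : E ∩ Ψ ⁻¹' {z | ∃ h, ∃ b ∈ B, z = α h * b * g} =
      ⋃ q : B ⧸ α.range.subgroupOf B,
        E ∩ Ψ ⁻¹' Set.range (fun h => α h * ((q.out : G)⁻¹ * g)) := by
    ext x
    simp only [Set.mem_inter_iff, Set.mem_preimage, Set.mem_iUnion, exists_and_left]
    refine and_congr_right fun _ => ⟨?_, ?_⟩
    · rintro ⟨h, b, hb, hx⟩
      obtain ⟨s, hs⟩ := QuotientGroup.mk_out_eq_mul (α.range.subgroupOf B) (⟨b, hb⟩ : B)⁻¹
      obtain ⟨k, hk⟩ := Subgroup.mem_subgroupOf.1 s.2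
      refine ⟨(((⟨b, hb⟩ : B)⁻¹ : B) : B ⧸ α.range.subgroupOf B), h * k, ?_⟩
      simp only [hs, hx, map_mul, hk]
      simp [mul_assoc]
    · rintro ⟨q, h, hx⟩
      exact ⟨h, _, inv_mem q.out.2, by rw [← hx, mul_assoc]⟩
  have hdisj : Pairwise (Function.onFun Disjoint fun q : B ⧸ α.range.subgroupOf B =>
      E ∩ Ψ ⁻¹' Set.range (fun h => α h * ((q.out : G)⁻¹ * g))) := by
    intro q q' hq
    refine Set.disjoint_left.2 ?_
    rintro x ⟨_, h, hx⟩ ⟨_, h', hx'⟩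
    refine hq ?_
    rw [← QuotientGroup.out_eq' q, ← QuotientGroup.out_eq' q', QuotientGroup.eq,
      Subgroup.mem_subgroupOf]
    have h1 : α h * ((q.out : G)⁻¹ * g) = α h' * ((q'.out : G)⁻¹ * g) := hx.trans hx'.symm
    rw [← mul_assoc, ← mul_assoc, mul_left_inj] at h1
    refine ⟨h⁻¹ * h', ?_⟩
    rw [map_mul, map_inv, Subgroup.coe_mul, Subgroup.coe_inv,
      inv_mul_eq_iff_eq_mul, ← mul_assoc, h1, inv_mul_cancel_right]
  have hmeas : ∀ q : B ⧸ α.range.subgroupOf B,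
      MeasurableSet (E ∩ Ψ ⁻¹' Set.range (fun h => α h * ((q.out : G)⁻¹ * g))) := fun q =>
    hE.inter (hΨm (Set.countable_range _).measurableSet)
  rw [hset, lintegral_iUnion hmeas hdisj, ← ENNReal.tsum_mul_left, ← ENNReal.tsum_const]
  refine tsum_congr fun q => ?_
  rw [← hw.measure_fiber_eq_card_ker _ hE hΨm hinv hΨ, hB _ (inv_mem q.out.2)]

end OneSided

variable [MeasurableConstSMul K S] [SMulInvariantMeasure K S m] [Countable K]
  [MeasurableConstSMul L S] [SMulInvariantMeasure L S m] [Countable L] [MeasurableInv G]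
  {E : Set S} {wK wL : S → ℝ≥0∞} {α : K →* G} {β : L →* G} {Ψ : S → G}

/-- An atom `g` of the image measure of an almost equivariant map forces `α(K)` and `g β(L) g⁻¹` to
be commensurable and compares the covolumes over the double coset `α(K) g β(L)`. -/
theorem atom_comparison (hE : MeasurableSet E) (hΨm : Measurable Ψ)
    (hinvK : AEInvariant K m E) (hwK : IsWeight K m E wK)
    (hinvL : AEInvariant L m E) (hwL : IsWeight L m E wL)
    (hα : ∀ k : K, ∀ᵐ x ∂m, x ∈ E → Ψ (k • x) = α k * Ψ x)
    (hβ : ∀ l : L, ∀ᵐ x ∂m, x ∈ E → Ψ (l • x) = Ψ x * (β l)⁻¹)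
    (hfinK : ∫⁻ x in E, wK x ∂m ≠ ∞) (hfinL : ∫⁻ x in E, wL x ∂m ≠ ∞) (hker : Finite α.ker)
    {g : G} (hg : m (E ∩ Ψ ⁻¹' {g}) ≠ 0) :
    Finite β.ker ∧ α.range.Commensurable (β.range.map (MulAut.conj g).toMonoidHom) ∧
    ((Nat.card α.ker * (β.range.map (MulAut.conj g).toMonoidHom).relIndex α.range : ℕ) : ℝ≥0∞) *
      ∫⁻ x in E ∩ Ψ ⁻¹' {z | ∃ k l, z = α k * g * β l}, wK x ∂m =
    ((Nat.card β.ker * α.range.relIndex (β.range.map (MulAut.conj g).toMonoidHom) : ℕ) : ℝ≥0∞) *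
      ∫⁻ x in E ∩ Ψ ⁻¹' {z | ∃ k l, z = α k * g * β l}, wL x ∂m := by
  set B := β.range.map (MulAut.conj g).toMonoidHom with hBdef
  set B' := α.range.map (MulAut.conj g⁻¹).toMonoidHom with hB'def
  have : Countable α.range := α.rangeRestrict_surjective.countable
  have : Countable β.range := β.rangeRestrict_surjective.countable
  have : Countable B := (MonoidHom.subgroupMap_surjective
    (MulAut.conj g).toMonoidHom β.range).countable
  have : Countable B' := (MonoidHom.subgroupMap_surjective
    (MulAut.conj g⁻¹).toMonoidHom α.range).countable
  -- The map `x ↦ (Ψ x)⁻¹` is equivariant on the left under `L`.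
  have hΨm' : Measurable fun x => (Ψ x)⁻¹ := hΨm.inv
  have hβ' : ∀ l : L, ∀ᵐ x ∂m, x ∈ E → (Ψ (l • x))⁻¹ = β l * (Ψ x)⁻¹ := fun l => by
    filter_upwards [hβ l] with x hx hxE
    rw [hx hxE, mul_inv_rev, inv_inv]
  have hpre : ∀ z : G, (fun x => (Ψ x)⁻¹) ⁻¹' {z⁻¹} = Ψ ⁻¹' {z} := fun z => by
    ext x
    simp
  have hmK : ∀ (k : K) (z : G), m (E ∩ Ψ ⁻¹' {z}) = m (E ∩ Ψ ⁻¹' {α k * z}) := fun k z => by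
    refine measure_eq_of_smul k (hE.inter (hΨm (measurableSet_singleton _))) ?_
    filter_upwards [hinvK k, hα k] with x hx1 hx2
    simp only [Set.mem_inter_iff, hx1, Set.mem_preimage, Set.mem_singleton_iff]
    refine and_congr_right fun hxE => ?_
    rw [hx2 hxE, mul_right_inj]
  have hmL : ∀ (l : L) (z : G), m (E ∩ Ψ ⁻¹' {z}) = m (E ∩ Ψ ⁻¹' {z * (β l)⁻¹}) := fun l z => by
    refine measure_eq_of_smul l (hE.inter (hΨm (measurableSet_singleton _))) ?_
    filter_upwards [hinvL l, hβ l] with x hx1 hx2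
    simp only [Set.mem_inter_iff, hx1, Set.mem_preimage, Set.mem_singleton_iff]
    refine and_congr_right fun hxE => ?_
    rw [hx2 hxE, mul_left_inj]
  have e1 := hwK.card_ker_mul_doubleCoset g hE hΨm hinvK hα B (by
    rintro b ⟨_, ⟨l, rfl⟩, rfl⟩
    rw [hmL l⁻¹ g]
    simp)
  have e2 := hwL.card_ker_mul_doubleCoset g⁻¹ hE hΨm' hinvL hβ' B' (by
    rintro b ⟨_, ⟨k, rfl⟩, rfl⟩
    have : MulAut.conj g⁻¹ (α k) * g⁻¹ = (α k⁻¹ * g)⁻¹ := by simp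
    change m (E ∩ _ ⁻¹' {MulAut.conj g⁻¹ (α k) * g⁻¹}) = _
    rw [this, hpre, hpre, ← hmK])
  have hO1 : {z | ∃ h, ∃ b ∈ B, z = α h * b * g} = {z | ∃ k l, z = α k * g * β l} := by
    ext z
    constructor
    · rintro ⟨k, _, ⟨_, ⟨l, rfl⟩, rfl⟩, rfl⟩
      exact ⟨k, l, by simp [mul_assoc]⟩
    · rintro ⟨k, l, rfl⟩
      exact ⟨k, _, ⟨_, ⟨l, rfl⟩, rfl⟩, by simp [mul_assoc]⟩
  have hO2 : (fun x => (Ψ x)⁻¹) ⁻¹' {z | ∃ h, ∃ b ∈ B', z = β h * b * g⁻¹} =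
      Ψ ⁻¹' {z | ∃ k l, z = α k * g * β l} := by
    ext x
    constructor
    · rintro ⟨l, _, ⟨_, ⟨k, rfl⟩, rfl⟩, hx⟩
      refine ⟨k⁻¹, l⁻¹, ?_⟩
      rw [← inv_inv (Ψ x)]
      refine (congrArg _ hx).trans ?_
      simp [mul_assoc]
    · rintro ⟨k, l, hx⟩
      refine ⟨l⁻¹, _, ⟨_, ⟨k⁻¹, rfl⟩, rfl⟩, ?_⟩
      simp [hx, mul_assoc]
  rw [hO1] at e1
  rw [hO2, hpre] at e2
  have hle : ∀ (w : S → ℝ≥0∞) (F : Set S), ∫⁻ x in E, w x ∂m ≠ ∞ →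
      ∫⁻ x in E ∩ F, w x ∂m ≠ ∞ := fun w F h =>
    ne_top_of_le_ne_top h (lintegral_mono_set Set.inter_subset_left)
  have hkα : (ENat.card α.ker : ℝ≥0∞) = Nat.card α.ker := by
    rw [ENat.card_eq_coe_natCard]; rfl
  -- The measure of the fibre is finite and positive. Since it equals the order of `ker β` times a
  -- covolume, that order is finite, and so are the indices.
  have hatop : m (E ∩ Ψ ⁻¹' {g}) ≠ ∞ := by
    rw [hwK.measure_fiber_eq_card_ker g hE hΨm hinvK hα, hkα]
    exact ENNReal.mul_ne_top (ENNReal.natCast_ne_top _) (hle _ _ hfinK)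
  have hkerL : Finite β.ker := by
    by_contra hc
    rw [not_finite_iff_infinite] at hc
    have := hwL.measure_fiber_eq_card_ker g⁻¹ hE hΨm' hinvL hβ'
    rw [hpre, ENat.card_eq_top_of_infinite] at this
    rw [this] at hg hatop
    rcases eq_or_ne (∫⁻ x in E ∩ (fun x => (Ψ x)⁻¹) ⁻¹' Set.range (fun h => β h * g⁻¹), wL x ∂m) 0
      with h0 | h0
    · simp [h0] at hg
    · simp [ENNReal.top_mul h0] at hatop
  have hkβ : (ENat.card β.ker : ℝ≥0∞) = Nat.card β.ker := by
    rw [ENat.card_eq_coe_natCard]; rfl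
  rw [hkα] at e1
  rw [hkβ] at e2
  have hr1 : α.range.relIndex B ≠ 0 := by
    refine relIndex_ne_zero_of_card _ _ fun hc => ?_
    rw [hc, ENNReal.top_mul hg] at e1
    exact ENNReal.mul_ne_top (ENNReal.natCast_ne_top _) (hle _ _ hfinK) e1
  have hr2 : β.range.relIndex B' ≠ 0 := by
    refine relIndex_ne_zero_of_card _ _ fun hc => ?_
    rw [hc, ENNReal.top_mul hg] at e2
    exact ENNReal.mul_ne_top (ENNReal.natCast_ne_top _) (hle _ _ hfinL) e2
  have hB'eq : β.range.relIndex B' = B.relIndex α.range := by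
    have h1 : α.range = B'.map (MulAut.conj g).toMonoidHom := by
      rw [hB'def, Subgroup.map_map]
      ext z
      simp [Subgroup.mem_map, mul_assoc]
    rw [h1, hBdef]
    exact (Subgroup.relIndex_map_map_of_injective _ _ (MulAut.conj g).injective).symm
  rw [card_quotient_subgroupOf _ _ hr1] at e1
  rw [card_quotient_subgroupOf _ _ hr2, hB'eq] at e2
  refine ⟨hkerL, ⟨hr1, hB'eq ▸ hr2⟩, ?_⟩
  push_cast
  rw [mul_right_comm, e1, mul_right_comm (Nat.card β.ker : ℝ≥0∞), e2]
  ring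

/-- Comparison of the covolumes of two commuting actions with an atomic almost equivariant map,
provided that the indices at the atoms and the kernels are bounded. -/
theorem covolume_le (hE : MeasurableSet E) (hΨm : Measurable Ψ)
    (hinvK : AEInvariant K m E) (hwK : IsWeight K m E wK)
    (hinvL : AEInvariant L m E) (hwL : IsWeight L m E wL)
    (hα : ∀ k : K, ∀ᵐ x ∂m, x ∈ E → Ψ (k • x) = α k * Ψ x)
    (hβ : ∀ l : L, ∀ᵐ x ∂m, x ∈ E → Ψ (l • x) = Ψ x * (β l)⁻¹)
    (hfinK : ∫⁻ x in E, wK x ∂m ≠ ∞) (hfinL : ∫⁻ x in E, wL x ∂m ≠ ∞) (hker : Finite α.ker)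
    {C : Set G} (hC : C.Countable) (hCE : ∀ᵐ x ∂m, x ∈ E → Ψ x ∈ C)
    {M : ℝ≥0∞} {N : ℕ} (hN : Finite β.ker → Nat.card β.ker ≤ N)
    (hM : ∀ g, m (E ∩ Ψ ⁻¹' {g}) ≠ 0 →
      α.range.Commensurable (β.range.map (MulAut.conj g).toMonoidHom) →
      (α.range.relIndex (β.range.map (MulAut.conj g).toMonoidHom) : ℝ≥0∞) ≤
        M * (β.range.map (MulAut.conj g).toMonoidHom).relIndex α.range) :
    ∫⁻ x in E, wK x ∂m ≤ N * M * ∫⁻ x in E, wL x ∂m := by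
  -- Split `E` into the preimages of the double cosets `α(K) g β(L)` that meet `C`.
  let r : G → DoubleCoset.Quotient (α.range : Set G) (β.range : Set G) :=
    fun z => Quotient.mk _ z
  have hr : ∀ y z, r y = r z ↔ ∃ k l, z = α k * y * β l := fun y z => by
    refine Quotient.eq.trans (DoubleCoset.rel_iff.trans ⟨?_, ?_⟩)
    · rintro ⟨_, ⟨k, rfl⟩, _, ⟨l, rfl⟩, h⟩
      exact ⟨k, l, h⟩
    · rintro ⟨k, l, h⟩
      exact ⟨_, ⟨k, rfl⟩, _, ⟨l, rfl⟩, h⟩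
  have hfib : ∀ g, r ⁻¹' {r g} = {z | ∃ k l, z = α k * g * β l} := fun g => by
    ext z
    exact eq_comm.trans (hr g z)
  have hfibc : ∀ q, (r ⁻¹' {q}).Countable := fun q => by
    obtain ⟨g, rfl⟩ : ∃ g, r g = q := Quotient.exists_rep q
    rw [hfib]
    have : {z | ∃ k l, z = α k * g * β l} = Set.range fun p : K × L => α p.1 * g * β p.2 := by
      ext z
      simp [eq_comm]
    rw [this]
    exact Set.countable_range _
  have : Countable (r '' C) := (hC.image r).to_subtype
  have hms : ∀ q : r '' C, MeasurableSet (E ∩ Ψ ⁻¹' (r ⁻¹' {q.1})) := fun q =>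
    hE.inter (hΨm (hfibc _).measurableSet)
  have hdisj : Pairwise (Function.onFun Disjoint
      fun q : r '' C => E ∩ Ψ ⁻¹' (r ⁻¹' {q.1})) := fun q q' hq =>
    Set.disjoint_left.2 fun x hx hx' => hq (Subtype.ext (hx.2.symm.trans hx'.2))
  have hcov : (⋃ q : r '' C, E ∩ Ψ ⁻¹' (r ⁻¹' {q.1}) : Set S) =ᵐ[m] E := by
    filter_upwards [hCE] with x hx
    refine propext ⟨?_, fun hxE => ?_⟩
    · intro h
      obtain ⟨q, hq⟩ := Set.mem_iUnion.1 h
      exact hq.1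
    · exact Set.mem_iUnion.2 ⟨⟨r (Ψ x), Set.mem_image_of_mem r (hx hxE)⟩, hxE, rfl⟩
  rw [← Measure.restrict_congr_set hcov, lintegral_iUnion hms hdisj, lintegral_iUnion hms hdisj,
    ← ENNReal.tsum_mul_left]
  refine ENNReal.tsum_le_tsum fun q => ?_
  by_cases hex : ∃ z, r z = q.1 ∧ m (E ∩ Ψ ⁻¹' {z}) ≠ 0
  · obtain ⟨g, hg, hg0⟩ := hex
    obtain ⟨h1, h2, h3⟩ := atom_comparison hE hΨm hinvK hwK hinvL hwL hα hβ hfinK hfinL hker hg0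
    rw [← hg, hfib]
    set JK := ∫⁻ x in E ∩ Ψ ⁻¹' {z | ∃ k l, z = α k * g * β l}, wK x ∂m
    set JL := ∫⁻ x in E ∩ Ψ ⁻¹' {z | ∃ k l, z = α k * g * β l}, wL x ∂m
    set p := α.range.relIndex (β.range.map (MulAut.conj g).toMonoidHom)
    set s := (β.range.map (MulAut.conj g).toMonoidHom).relIndex α.range
    have hs0 : (s : ℝ≥0∞) ≠ 0 := by exact_mod_cast h2.2
    refine (ENNReal.mul_le_mul_iff_right hs0 (ENNReal.natCast_ne_top s)).1 ?_
    have hk1 : (1 : ℝ≥0∞) ≤ (Nat.card α.ker : ℝ≥0∞) := by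
      exact_mod_cast Nat.card_pos
    calc (s : ℝ≥0∞) * JK ≤ Nat.card α.ker * (s * JK) := le_mul_of_one_le_left' hk1
      _ = (Nat.card β.ker * p : ℕ) * JL := by rw [← h3]; push_cast; ring
      _ ≤ (N * (M * s)) * JL := by
          push_cast
          gcongr
          · exact hN h1
          · exact hM g hg0 h2
      _ = s * (N * M * JL) := by ring
  · -- The preimage of a double coset without atoms is null, as the double coset is countable.
    push Not at hex
    have h0 : m (E ∩ Ψ ⁻¹' (r ⁻¹' {q.1})) = 0 := by
      have : E ∩ Ψ ⁻¹' (r ⁻¹' {q.1}) = ⋃ z ∈ r ⁻¹' {q.1}, E ∩ Ψ ⁻¹' {z} := by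
        ext x
        simp
      rw [this]
      exact (measure_biUnion_null_iff (hfibc _)).2 fun z hz => hex z hz
    rw [Measure.restrict_eq_zero.2 h0]
    simp

end Index

/-! ### Subcouplings and their orbits of vertices -/

section Subcoupling

variable {Γ Λ S V : Type*} [Group Γ] [Group Λ] [MulAction Γ S] [MulAction Λ S]
  [MeasurableSpace S] [MulAction Γ V] [MulAction Λ V]

/-- The set `E` with the actions of the subgroups `K` of `Γ` and `L` of `Λ` is a coupling in which
`K` has covolume `κ` and `L` has covolume `ℓ`, computed by weights. -/
structure IsSubcoupling (m : Measure S) (K : Subgroup Γ) (L : Subgroup Λ) (E : Set S)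
    (κ ℓ : ℝ≥0∞) : Prop where
  measurableSet : MeasurableSet E
  left_inv : AEInvariant K m E
  right_inv : AEInvariant L m E
  left_weight : ∃ w, IsWeight K m E w ∧ ∫⁻ x in E, w x ∂m = κ
  right_weight : ∃ w, IsWeight L m E w ∧ ∫⁻ x in E, w x ∂m = ℓ

/-- The map `Θ` into the permutations of the set `V` is almost equivariant under the actions of
`Γ` and `Λ`, and Borel for pointwise convergence. -/
structure IsAlmostEquivariantPerm (Γ Λ : Type*) {S V : Type*} [Group Γ] [Group Λ] [MulAction Γ S]
    [MulAction Λ S] [MeasurableSpace S] [MulAction Γ V] [MulAction Λ V] (m : Measure S)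
    (Θ : S → Equiv.Perm V) : Prop where
  measurableSet : ∀ u v, MeasurableSet {x | Θ x u = v}
  left : ∀ γ : Γ, ∀ᵐ x ∂m, ∀ u, Θ (γ • x) u = γ • Θ x u
  right : ∀ l : Λ, ∀ᵐ x ∂m, ∀ u, Θ (l • x) (l • u) = Θ x u

theorem IsWeight.congr_subgroup {H : Type*} [Group H] [MulAction H S] {K₀ : Subgroup H}
    {K₁ : Subgroup K₀} {K₂ : Subgroup H} (h : ∀ k : K₀, k ∈ K₁ ↔ (k : H) ∈ K₂) (hle : K₂ ≤ K₀)
    {m : Measure S} {E : Set S} {w : S → ℝ≥0∞} (hw : IsWeight K₁ m E w) : IsWeight K₂ m E w := by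
  let e : K₂ ≃ K₁ :=
    { toFun := fun k => ⟨⟨k.1, hle k.2⟩, (h _).2 k.2⟩
      invFun := fun k => ⟨k.1.1, (h _).1 k.2⟩
      left_inv := fun _ => rfl
      right_inv := fun _ => rfl }
  exact hw.congr_equiv e fun _ _ => rfl

theorem stabilizer_mem_iff_inf {H X : Type*} [Group H] [MulAction H X] (K : Subgroup H) (y : X)
    (k : K) : k ∈ MulAction.stabilizer K y ↔ (k : H) ∈ K ⊓ MulAction.stabilizer H y :=
  ⟨fun h => ⟨k.2, h⟩, fun h => h.2⟩

variable {m : Measure S} {K : Subgroup Γ} {L : Subgroup Λ} {E : Set S} {κ ℓ : ℝ≥0∞}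
  {Θ : S → Equiv.Perm V}

theorem IsAlmostEquivariantPerm.right_symm (hΘ : IsAlmostEquivariantPerm Γ Λ m Θ) (l : Λ) :
    ∀ᵐ x ∂m, ∀ u, (Θ (l • x)).symm u = l • (Θ x).symm u := by
  filter_upwards [hΘ.right l] with x hx u
  rw [Equiv.symm_apply_eq, hx, Equiv.apply_symm_apply]

variable [MeasurableConstSMul Λ S] [SMulInvariantMeasure Λ S m] [Countable Λ]

theorem IsSubcoupling.right_ne_zero (hE : IsSubcoupling m K L E κ ℓ) (hκ : κ ≠ 0) : ℓ ≠ 0 := by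
  rintro rfl
  obtain ⟨w, hw, h0⟩ := hE.right_weight
  obtain ⟨w', hw', h1⟩ := hE.left_weight
  have := hw.measure_eq hE.measurableSet hE.right_inv
  rw [h0, mul_zero] at this
  rw [Measure.restrict_eq_zero.2 this, lintegral_zero_measure] at h1
  exact hκ h1.symm

variable [MeasurableConstSMul Γ S] [SMulInvariantMeasure Γ S m] [SMulCommClass Γ Λ S]

/-- The subcoupling of the elements `x` of `E` such that `Θ x` fixes the vertex `u`. If `K` is
transitive on a set `U` of vertices that is preserved by almost every `Θ x`, then the stabilizer of
`u` in `K` has the same covolume as `K`, while the covolume of the stabilizer in `L` is that of `L`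
on the part of `E` that belongs to the `L`-orbit of `u`. -/
theorem IsSubcoupling.fix [Countable Γ] (hE : IsSubcoupling m K L E κ ℓ)
    (hΘ : IsAlmostEquivariantPerm Γ Λ m Θ)
    {U : Set V} (hU : ∀ᵐ x ∂m, x ∈ E → ∀ u, Θ x u ∈ U ↔ u ∈ U)
    (hK : ∀ u ∈ U, ∀ u' ∈ U, ∃ k ∈ K, k • u = u') {u₀ u : V} (hu₀ : u₀ ∈ U) (hu : u ∈ U)
    {w : S → ℝ≥0∞} (hw : IsWeight L m E w) :
    IsSubcoupling m (K ⊓ MulAction.stabilizer Γ u) (L ⊓ MulAction.stabilizer Λ u)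
      (E ∩ {x | Θ x u = u}) κ
      (∫⁻ x in E ∩ {x | ∃ l ∈ L, (Θ x).symm u₀ = l • u}, w x ∂m) := by
  have hmeas : ∀ v v', MeasurableSet (E ∩ {x | Θ x v = v'}) := fun v v' =>
    hE.measurableSet.inter (hΘ.measurableSet v v')
  refine ⟨hmeas u u, ?_, ?_, ?_, ?_⟩
  · intro k
    filter_upwards [hE.left_inv ⟨k.1, k.2.1⟩, hΘ.left k.1] with x hx1 hx2
    refine and_congr hx1 ?_
    change Θ (k.1 • x) u = u ↔ Θ x u = u
    rw [hx2, smul_eq_iff_eq_inv_smul, MulAction.mem_stabilizer_iff.1 (inv_mem k.2.2)]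
  · intro l
    filter_upwards [hE.right_inv ⟨l.1, l.2.1⟩, hΘ.right l.1] with x hx1 hx2
    refine and_congr hx1 ?_
    change Θ (l.1 • x) u = u ↔ Θ x u = u
    have := hx2 u
    rw [MulAction.mem_stabilizer_iff.1 l.2.2] at this
    rw [this]
  · obtain ⟨wK, hwK, hκ⟩ := hE.left_weight
    obtain ⟨w', hw', h⟩ := hwK.exists_fiber (Ψ := fun x => Θ x u) u hE.left_inv
      (fun k => (hΘ.left k.1).mono fun x hx _ => hx u) (fun k => hmeas u _)
    refine ⟨w', hw'.congr_subgroup (stabilizer_mem_iff_inf K u) inf_le_left, ?_⟩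
    change ∫⁻ x in E ∩ (fun x => Θ x u) ⁻¹' {u}, w' x ∂m = κ
    rw [h, ← hκ]
    refine congrArg (fun μ => ∫⁻ x, wK x ∂μ) (Measure.restrict_congr_set ?_)
    filter_upwards [hU] with x hx
    refine propext ⟨fun h => h.1, fun hxE => ⟨hxE, ?_⟩⟩
    obtain ⟨k, hk, hku⟩ := hK u hu _ ((hx hxE u).2 hu)
    exact ⟨⟨k, hk⟩, hku⟩
  · -- Translate the weight by an element of `K` that moves `u₀` to `u`.
    obtain ⟨γ, hγ, hγu⟩ := hK u₀ hu₀ u hu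
    have hwγ : IsWeight L m E fun x => w (γ⁻¹ • x) := by
      refine ⟨hw.measurable.comp (measurable_const_smul _), ?_⟩
      filter_upwards [ae_smul (m := m) γ⁻¹ hw.sum_eq, hE.left_inv ⟨γ, hγ⟩⁻¹] with x hx hx' hxE
      rw [← hx (hx'.2 hxE)]
      refine tsum_congr fun l => ?_
      rw [Subgroup.smul_def, Subgroup.smul_def, smul_comm]
    have hpre : ∀ v v', {x | (Θ x).symm v = v'} = {x | Θ x v' = v} := fun v v' => by
      ext x
      exact (Equiv.symm_apply_eq _).trans eq_comm
    obtain ⟨w', hw', h⟩ := hwγ.exists_fiber (Ψ := fun x => (Θ x).symm u) u hE.right_inv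
      (fun l => (hΘ.right_symm l.1).mono fun x hx _ => hx u) (fun l => by
        have := hmeas (l • u) u
        rw [← hpre] at this
        exact this)
    have hset : E ∩ (fun x => (Θ x).symm u) ⁻¹' {u} = E ∩ {x | Θ x u = u} := by
      rw [← hpre]
      rfl
    rw [hset] at h hw'
    refine ⟨w', hw'.congr_subgroup (stabilizer_mem_iff_inf L u) inf_le_left, ?_⟩
    rw [h]
    have hm1 : ∀ v, MeasurableSet (E ∩ {x | ∃ l ∈ L, (Θ x).symm v = l • u}) := fun v => by
      have : E ∩ {x | ∃ l ∈ L, (Θ x).symm v = l • u} = ⋃ l : L, E ∩ {x | Θ x (l • u) = v} := by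
        ext x
        simp only [Set.mem_inter_iff, Set.mem_ofPred_eq, Set.mem_iUnion, exists_and_left,
          Subtype.exists, Equiv.symm_apply_eq, @eq_comm _ v]
        simp [Subgroup.smul_def]
      rw [this]
      exact MeasurableSet.iUnion fun l => hmeas _ _
    have hset2 : E ∩ (fun x => (Θ x).symm u) ⁻¹' MulAction.orbit L u =
        E ∩ {x | ∃ l ∈ L, (Θ x).symm u = l • u} := by
      ext x
      simp [MulAction.mem_orbit_iff, Subgroup.smul_def, eq_comm]
    rw [hset2]
    refine setLIntegral_smul γ⁻¹ (hm1 _) ?_ hw.measurable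
    filter_upwards [hE.left_inv ⟨γ, hγ⟩⁻¹, hΘ.left γ⁻¹] with x hx1 hx2
    refine and_congr hx1 ?_
    have : (Θ (γ⁻¹ • x)).symm u₀ = (Θ x).symm u := by
      rw [Equiv.symm_apply_eq, hx2, Equiv.apply_symm_apply, ← hγu, inv_smul_smul]
    change (∃ l ∈ L, (Θ (γ⁻¹ • x)).symm u₀ = l • u) ↔ ∃ l ∈ L, (Θ x).symm u = l • u
    rw [this]

/-- If the covolume of the stabilizer in `L` of a vertex of `U` is bounded away from zero, then `L`
has finitely many orbits on `U`, because these covolumes add up to at most the covolume of `L`. -/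
theorem IsSubcoupling.finite_orbits [Countable Γ] (hE : IsSubcoupling m K L E κ ℓ)
    (hΘ : IsAlmostEquivariantPerm Γ Λ m Θ) {U : Set V}
    (hU : ∀ᵐ x ∂m, x ∈ E → ∀ u, Θ x u ∈ U ↔ u ∈ U)
    (hK : ∀ u ∈ U, ∀ u' ∈ U, ∃ k ∈ K, k • u = u') (hℓ : ℓ ≠ ∞) {ε : ℝ≥0∞} (hε : 0 < ε)
    (hbound : ∀ u ∈ U, ∀ ℓ' ≤ ℓ, IsSubcoupling m (K ⊓ MulAction.stabilizer Γ u)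
      (L ⊓ MulAction.stabilizer Λ u) (E ∩ {x | Θ x u = u}) κ ℓ' → ε ≤ ℓ') :
    {O : Set V | ∃ u ∈ U, O = {v | ∃ l ∈ L, v = l • u}}.Finite := by
  rcases U.eq_empty_or_nonempty with rfl | ⟨u₀, hu₀⟩
  · simp
  obtain ⟨w, hw, hwℓ⟩ := hE.right_weight
  set 𝒪 := {O : Set V | ∃ u ∈ U, O = {v | ∃ l ∈ L, v = l • u}} with h𝒪
  set μ := (m.restrict E).withDensity w
  let As : 𝒪 → Set S := fun O => E ∩ {x | (Θ x).symm u₀ ∈ O.1}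
  have hAs : ∀ O, MeasurableSet (As O) := by
    rintro ⟨_, u, hu, rfl⟩
    have : As ⟨_, u, hu, rfl⟩ = ⋃ l : L, E ∩ {x | Θ x (l • u) = u₀} := by
      ext x
      simp only [As, Set.mem_inter_iff, Set.mem_ofPred_eq, Set.mem_iUnion, exists_and_left,
        Subtype.exists, Equiv.symm_apply_eq, @eq_comm _ u₀]
      simp [Subgroup.smul_def]
    rw [this]
    exact MeasurableSet.iUnion fun l => hE.measurableSet.inter (hΘ.measurableSet _ _)
  have hdisj : Pairwise (Function.onFun Disjoint As) := by
    rintro ⟨O, u, hu, hO⟩ ⟨O', u', hu', hO'⟩ hne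
    refine Set.disjoint_left.2 fun x hx hx' => hne (Subtype.ext ?_)
    have h1 : (Θ x).symm u₀ ∈ O := hx.2
    have h2 : (Θ x).symm u₀ ∈ O' := hx'.2
    rw [hO] at h1
    rw [hO'] at h2
    obtain ⟨l, hl, h1⟩ := h1
    obtain ⟨l', hl', h2⟩ := h2
    have h3 : u = (l⁻¹ * l') • u' := by
      rw [mul_smul, ← h2, h1, inv_smul_smul]
    change O = O'
    rw [hO, hO']
    ext v
    constructor
    · rintro ⟨g, hg, rfl⟩
      exact ⟨g * (l⁻¹ * l'), mul_mem hg (mul_mem (inv_mem hl) hl'), by rw [h3, ← mul_smul]⟩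
    · rintro ⟨g, hg, rfl⟩
      refine ⟨g * (l⁻¹ * l')⁻¹, mul_mem hg (inv_mem (mul_mem (inv_mem hl) hl')), ?_⟩
      rw [h3, ← mul_smul, inv_mul_cancel_right]
  have hμ : ∀ A, MeasurableSet A → μ (E ∩ A) = ∫⁻ x in E ∩ A, w x ∂m := fun A hA => by
    rw [withDensity_apply _ (hE.measurableSet.inter hA), Measure.restrict_restrict
      (hE.measurableSet.inter hA), Set.inter_right_comm, Set.inter_self]
  have hμE : μ Set.univ = ℓ := by
    rw [withDensity_apply _ MeasurableSet.univ, Measure.restrict_univ, hwℓ]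
  have hfin := Measure.finite_const_le_meas_of_disjoint_iUnion μ hε hAs hdisj
    (ne_top_of_le_ne_top (hμE ▸ hℓ) (measure_mono (Set.subset_univ _)))
  have hall : {O | ε ≤ μ (As O)} = Set.univ := by
    refine Set.eq_univ_of_forall ?_
    rintro ⟨_, u, hu, rfl⟩
    have h1 : μ (As ⟨_, u, hu, rfl⟩) =
        ∫⁻ x in E ∩ {x | ∃ l ∈ L, (Θ x).symm u₀ = l • u}, w x ∂m := by
      rw [withDensity_apply _ (hAs _), Measure.restrict_restrict (hAs _)]
      congr 2
      exact Set.inter_eq_left.2 Set.inter_subset_left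
    change ε ≤ μ _
    rw [h1]
    exact hbound u hu _ (hwℓ ▸ lintegral_mono_set Set.inter_subset_left)
      (hE.fix hΘ hU hK hu₀ hu hw)
  rw [hall] at hfin
  exact Set.finite_coe_iff.1 (Set.finite_univ_iff.1 hfin)

/-- Suppose that `L` has a finite orbit on `V`, consisting of vertices that almost every `Θ x` sends
into a set `Y` in which all the orbits of `K` are infinite. This is impossible in a coupling of
finite covolume: the parts of `E` where the image of the finite orbit contains a given element `y`
of `Y` have a covolume under `L` that is constant on `K`-orbits and sums up to a finite number. -/
theorem IsSubcoupling.infinite_orbit (hE : IsSubcoupling m K L E κ ℓ)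
    (hΘ : IsAlmostEquivariantPerm Γ Λ m Θ) [Countable V] (hκ : κ ≠ 0) (hℓ : ℓ ≠ ∞) {Y : Set V}
    (hY : ∀ y ∈ Y, {v | ∃ k ∈ K, v = k • y}.Infinite) {u : V}
    (hu : ∀ᵐ x ∂m, x ∈ E → ∀ l ∈ L, Θ x (l • u) ∈ Y) : {v | ∃ l ∈ L, v = l • u}.Infinite := by
  intro hfin
  obtain ⟨w, hw, hwℓ⟩ := hE.right_weight
  set F := {v | ∃ l ∈ L, v = l • u} with hF
  let A : V → Set S := fun y => E ∩ {x | (Θ x).symm y ∈ F}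
  have hpre : ∀ v v', {x | (Θ x).symm v = v'} = {x | Θ x v' = v} := fun v v' => by
    ext x
    exact (Equiv.symm_apply_eq _).trans eq_comm
  have hAm : ∀ y, MeasurableSet (A y) := fun y => by
    have : {x | (Θ x).symm y ∈ F} = ⋃ v ∈ F, {x | (Θ x).symm y = v} := by
      ext x
      simp
    simp only [A, this, hpre]
    exact hE.measurableSet.inter
      (MeasurableSet.biUnion (Set.to_countable _) fun v _ => hΘ.measurableSet _ _)
  have hAinv : ∀ y, AEInvariant L m (A y) := fun y l => by
    filter_upwards [hE.right_inv l, hΘ.right_symm l.1] with x hx1 hx2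
    refine and_congr hx1 ?_
    change (Θ (l.1 • x)).symm y ∈ F ↔ _
    rw [hx2]
    constructor
    · rintro ⟨l', hl', h⟩
      exact ⟨l.1⁻¹ * l', mul_mem (inv_mem l.2) hl', by rw [mul_smul, ← h, inv_smul_smul]⟩
    · rintro ⟨l', hl', h⟩
      exact ⟨l.1 * l', mul_mem l.2 hl', by rw [mul_smul, ← h]⟩
  have hAK : ∀ k ∈ K, ∀ y, ∫⁻ x in A (k • y), w x ∂m = ∫⁻ x in A y, w x ∂m := fun k hk y => by
    have hwk : IsWeight L m E fun x => w (k • x) := by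
      refine ⟨hw.measurable.comp (measurable_const_smul _), ?_⟩
      filter_upwards [ae_smul (m := m) k hw.sum_eq, hE.left_inv ⟨k, hk⟩] with x hx hx' hxE
      rw [← hx (hx'.2 hxE)]
      refine tsum_congr fun l => ?_
      rw [Subgroup.smul_def, Subgroup.smul_def, smul_comm]
    rw [(hw.mono Set.inter_subset_left).setLIntegral_eq (hAm y) (hAinv y)
      (hwk.mono Set.inter_subset_left)]
    refine (setLIntegral_smul k (hAm _) ?_ hw.measurable).symm
    filter_upwards [hE.left_inv ⟨k, hk⟩, hΘ.left k] with x hx1 hx2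
    refine and_congr hx1 ?_
    have : (Θ (k • x)).symm (k • y) = (Θ x).symm y := by
      rw [Equiv.symm_apply_eq, hx2, Equiv.apply_symm_apply]
    change (Θ (k • x)).symm (k • y) ∈ F ↔ _
    rw [this]
    rfl
  have hsum : ∑' y : V, ∫⁻ x in A y, w x ∂m = ENat.card F * ℓ := by
    have h1 : ∀ y, ∫⁻ x in A y, w x ∂m =
        ∑' v : F, ∫⁻ x in E ∩ {x | Θ x v = y}, w x ∂m := fun y => by
      have h2 : A y = ⋃ v : F, E ∩ {x | Θ x v = y} := by
        ext x
        simp only [A, Set.mem_inter_iff, Set.mem_ofPred_eq, Set.mem_iUnion, exists_and_left]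
        refine and_congr_right fun _ => ⟨fun h => ⟨⟨_, h⟩, (Θ x).apply_symm_apply y⟩, ?_⟩
        rintro ⟨v, rfl⟩
        rw [Equiv.symm_apply_apply]
        exact v.2
      rw [h2, lintegral_iUnion
        (fun v => hE.measurableSet.inter (hΘ.measurableSet _ _)) fun v v' hv =>
          Set.disjoint_left.2 fun x hx hx' => hv (Subtype.ext
            ((Θ x).injective (hx.2.trans hx'.2.symm)))]
    simp only [h1]
    rw [ENNReal.tsum_comm, ← ENNReal.tsum_const]
    refine tsum_congr fun v => ?_
    rw [← hwℓ, ← lintegral_iUnion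
      (fun y => hE.measurableSet.inter (hΘ.measurableSet _ _)) fun y y' hy =>
        Set.disjoint_left.2 fun x hx hx' => hy (hx.2.symm.trans hx'.2)]
    congr 2
    ext x
    simp
  have hsumtop : ∑' y : V, ∫⁻ x in A y, w x ∂m ≠ ∞ := by
    have : Finite F := hfin
    rw [hsum, ENat.card_eq_coe_natCard]
    exact ENNReal.mul_ne_top (ENNReal.natCast_ne_top _) hℓ
  -- A constant on an infinite orbit has a finite sum only if it is zero.
  have hzero : ∀ y, ∫⁻ x in A y, w x ∂m = 0 := fun y => by
    by_cases hy : y ∈ Y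
    · by_contra hne
      have : Infinite {v | ∃ k ∈ K, v = k • y} := (hY y hy).to_subtype
      refine hsumtop (top_le_iff.1 ?_)
      calc (∞ : ℝ≥0∞) = ∑' v : {v | ∃ k ∈ K, v = k • y}, ∫⁻ x in A y, w x ∂m :=
            (ENNReal.tsum_const_eq_top_of_ne_zero hne).symm
        _ = ∑' v : {v | ∃ k ∈ K, v = k • y}, ∫⁻ x in A v, w x ∂m := by
            refine tsum_congr fun v => ?_
            obtain ⟨_, k, hk, rfl⟩ := v
            exact (hAK k hk y).symm
        _ ≤ _ := ENNReal.tsum_comp_le_tsum_of_injective Subtype.val_injective _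
    · have h0 : m (A y) = 0 := by
        refine measure_mono_null ?_ hu
        rintro x ⟨hxE, l, hl, hx⟩ hx'
        refine hy ?_
        have := hx' hxE l hl
        rwa [← hx, Equiv.apply_symm_apply] at this
      rw [Measure.restrict_eq_zero.2 h0, lintegral_zero_measure]
  simp only [hzero, tsum_zero] at hsum
  have hne : Nonempty F := ⟨⟨u, 1, one_mem _, (one_smul _ _).symm⟩⟩
  rcases mul_eq_zero.1 hsum.symm with h | h
  · have h' : ENat.card F = 0 := by simpa using h
    exact ENat.card_ne_zero h'
  · exact hE.right_ne_zero hκ h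

end Subcoupling

/-! ### Stabilizers in the Bass-Serre tree -/

theorem relIndex_stabilizer_ne_zero {H X : Type*} [Group H] [MulAction H X] {K : Subgroup H} {x : X}
    (hfin : {u | ∃ k ∈ K, u = k • x}.Finite) : (MulAction.stabilizer H x).relIndex K ≠ 0 := by
  have horb : MulAction.orbit K x = {u | ∃ k ∈ K, u = k • x} := by
    ext u
    simp [MulAction.mem_orbit_iff, Subgroup.smul_def, eq_comm]
  have h2 := MulAction.index_stabilizer K x
  rw [horb] at h2
  exact (h2.trans_ne ((Set.ncard_pos hfin).2 ⟨x, 1, one_mem _, (one_smul _ _).symm⟩).ne')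

section Tree

variable {A : Type*} {Γ : Fin 2 → Type*} [Group A] [∀ i, Group (Γ i)] {φ : ∀ i, A →* Γ i}

theorem countable_pushoutI (hφ : ∀ i, Function.Injective (φ i)) [∀ i, Countable (Γ i)] :
    Countable (PushoutI φ) := by
  have : Countable A := (hφ 0).countable
  have h1 : Countable (FreeMonoid (Σ i, Γ i)) := inferInstanceAs (Countable (List _))
  have h2 : Countable (CoprodI Γ) := (Con.mk'_surjective (c := CoprodI.Rel Γ |> conGen)).countable
  have h3 : Countable (FreeMonoid (CoprodI Γ ⊕ A)) := inferInstanceAs (Countable (List _))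
  have h4 : Countable (Coprod (CoprodI Γ) A) := (Coprod.mk_surjective).countable
  exact (Con.mk'_surjective (c := PushoutI.con φ)).countable

theorem countable_vertex [Countable (PushoutI φ)] : Countable (Vertex φ) := by
  have : ∀ i, Countable (PushoutI φ ⧸ factor φ i) := fun i => Quotient.countable
  infer_instance

theorem coset_eq_iff {i : Fin 2} {γ δ : PushoutI φ} :
    coset φ i γ = coset φ i δ ↔ γ⁻¹ * δ ∈ factor φ i := by
  simp only [coset, Sigma.mk.injEq, heq_eq_eq, true_and]
  exact QuotientGroup.eq

theorem smul_coset (i : Fin 2) (γ δ : PushoutI φ) : γ • coset φ i δ = coset φ i (γ * δ) := rfl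

theorem exists_coset (v : Vertex φ) : ∃ γ, v = coset φ v.1 γ := by
  obtain ⟨i, q⟩ := v
  induction q using QuotientGroup.induction_on with
  | H γ => exact ⟨γ, rfl⟩

theorem adj_iff {u v : Vertex φ} : (bassSerreTree φ).Adj u v ↔
    u.1 ≠ v.1 ∧ ∃ δ, u = coset φ u.1 δ ∧ v = coset φ v.1 δ := by
  constructor
  · rintro (⟨δ, rfl, rfl⟩ | ⟨δ, rfl, rfl⟩)
    · exact ⟨by simp [coset], δ, rfl, rfl⟩
    · exact ⟨by simp [coset], δ, rfl, rfl⟩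
  · obtain ⟨i, p⟩ := u
    obtain ⟨j, q⟩ := v
    rintro ⟨hne, δ, h1, h2⟩
    rw [h1, h2]
    have : i = 0 ∧ j = 1 ∨ i = 1 ∧ j = 0 := by
      simp only at hne
      omega
    rcases this with ⟨rfl, rfl⟩ | ⟨rfl, rfl⟩
    · exact Or.inl ⟨δ, rfl, rfl⟩
    · exact Or.inr ⟨δ, rfl, rfl⟩

theorem autT_fst (f : AutT φ) (v : Vertex φ) : (f.1 v).1 = v.1 := by
  obtain ⟨γ, hγ⟩ := exists_coset v
  have h : OrientedEdge φ (f.1 (coset φ 0 γ)) (f.1 (coset φ 1 γ)) := (f.2 _ _).2 ⟨γ, rfl, rfl⟩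
  obtain ⟨δ, h0, h1⟩ := h
  have hi : v.1 = 0 ∨ v.1 = 1 := by omega
  rcases hi with hi | hi <;> rw [hi] at hγ ⊢ <;> rw [hγ]
  · rw [h0]; rfl
  · rw [h1]; rfl

theorem measurableSet_apply_eq (u v : Vertex φ) : MeasurableSet {f : AutT φ | f.1 u = v} := by
  let _ : TopologicalSpace (Vertex φ) := ⊥
  have _ : DiscreteTopology (Vertex φ) := ⟨rfl⟩
  have h : IsOpen {f : AutT φ | f.1 u = v} := by
    refine isOpen_induced_iff.2 ⟨{g : Vertex φ → Vertex φ | g u = v}, ?_, rfl⟩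
    have hc : Continuous fun g : Vertex φ → Vertex φ => g u := continuous_apply u
    exact (isOpen_discrete ({v} : Set (Vertex φ))).preimage hc
  exact MeasurableSpace.measurableSet_generateFrom h

theorem autT_mem_vertexClass (f : AutT φ) (i : Fin 2) (u : Vertex φ) :
    f.1.toEquiv u ∈ vertexClass φ i ↔ u ∈ vertexClass φ i := by
  change (f.1 u).1 = i ↔ u.1 = i
  rw [autT_fst]

theorem autT_mem_neighborSet {v : Vertex φ} {f : AutT φ} (hf : f ∈ vertexStab φ v) (u : Vertex φ) :
    f.1.toEquiv u ∈ (bassSerreTree φ).neighborSet v ↔ u ∈ (bassSerreTree φ).neighborSet v := by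
  have hv : f.1 v = v := hf
  have := f.1.map_adj_iff (v := v) (w := u)
  rw [hv] at this
  exact this

theorem mem_amalgamStab {v : Vertex φ} {γ : PushoutI φ} : γ ∈ amalgamStab φ v ↔ γ • v = v :=
  Iff.rfl

theorem amalgamStab_eq (v : Vertex φ) :
    amalgamStab φ v = MulAction.stabilizer (PushoutI φ) v := rfl

theorem exists_smul_of_fst_eq {u v : Vertex φ} (h : u.1 = v.1) : ∃ γ : PushoutI φ, γ • u = v := by
  obtain ⟨γ, hγ⟩ := exists_coset u
  obtain ⟨δ, hδ⟩ := exists_coset v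
  refine ⟨δ * γ⁻¹, ?_⟩
  rw [hγ, hδ, smul_coset, inv_mul_cancel_right, h]

theorem exists_smul_of_mem_vertexClass {i : Fin 2} : ∀ u ∈ vertexClass φ i,
    ∀ u' ∈ vertexClass φ i, ∃ k ∈ (⊤ : Subgroup (PushoutI φ)), k • u = u' := by
  intro u hu u' hu'
  obtain ⟨γ, hγ⟩ := exists_smul_of_fst_eq (Eq.trans hu (Eq.symm hu'))
  exact ⟨γ, Subgroup.mem_top _, hγ⟩

/-- The stabilizer of a vertex acts transitively on the link. -/
theorem exists_amalgamStab_smul {v u w : Vertex φ} (hu : (bassSerreTree φ).Adj v u)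
    (hw : (bassSerreTree φ).Adj v w) : ∃ γ ∈ amalgamStab φ v, γ • u = w := by
  obtain ⟨h1, γ, hv, hu⟩ := adj_iff.1 hu
  obtain ⟨h2, δ, hv', hw⟩ := adj_iff.1 hw
  have h3 : u.1 = w.1 := by omega
  refine ⟨δ * γ⁻¹, ?_, ?_⟩
  · rw [mem_amalgamStab]
    nth_rw 1 [hv]
    rw [smul_coset, inv_mul_cancel_right, ← hv']
  · rw [hu, hw, smul_coset, inv_mul_cancel_right, h3]

/-- The Bass-Serre tree is connected, in the form used here: a function that agrees on adjacent
vertices is constant. -/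
theorem eq_of_forall_adj {X : Type*} (F : Vertex φ → X)
    (hF : ∀ u v, (bassSerreTree φ).Adj u v → F u = F v) (u v : Vertex φ) : F u = F v := by
  have hadj : ∀ γ : PushoutI φ, F (coset φ 0 γ) = F (coset φ 1 γ) := fun γ =>
    hF _ _ (Or.inl ⟨γ, rfl, rfl⟩)
  have hof : ∀ (i : Fin 2) (g : Γ i) (δ : PushoutI φ),
      coset φ i (δ * PushoutI.of i g) = coset φ i δ := fun i g δ => by
    rw [eq_comm, coset_eq_iff, inv_mul_cancel_left]
    exact ⟨g, rfl⟩
  have key : ∀ x δ : PushoutI φ, F (coset φ 0 (δ * x)) = F (coset φ 0 δ) := fun x => by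
    induction x using PushoutI.induction_on with
    | of i g =>
      intro δ
      fin_cases i
      · exact congrArg F (hof 0 g δ)
      · rw [hadj, hadj]
        exact congrArg F (hof 1 g δ)
    | base h =>
      intro δ
      rw [← PushoutI.of_apply_eq_base φ 0, hof]
    | mul x y hx hy =>
      intro δ
      rw [← mul_assoc, hy, hx]
  have h0 : ∀ w : Vertex φ, F w = F (coset φ 0 1) := fun w => by
    obtain ⟨γ, hγ⟩ := exists_coset w
    have hi : w.1 = 0 ∨ w.1 = 1 := by omega
    rcases hi with hi | hi <;> rw [hi] at hγ <;> rw [hγ]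
    · simpa using key γ 1
    · rw [← hadj]
      simpa using key γ 1
  rw [h0 u, h0 v]

theorem of_mem_factor_iff (hφ : ∀ i, Function.Injective (φ i)) {i j : Fin 2}
    (hij : i ≠ j) (a : Γ i) :
    PushoutI.of (φ := φ) i a ∈ factor φ j ↔ a ∈ (φ i).range := by
  have h := PushoutI.inf_of_range_eq_base_range hφ hij
  constructor
  · intro ha
    have h1 : PushoutI.of (φ := φ) i a ∈ (PushoutI.base φ).range := by
      rw [← h]
      exact ⟨⟨a, rfl⟩, ha⟩
    obtain ⟨b, hb⟩ := h1
    refine ⟨b, PushoutI.of_injective hφ i ?_⟩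
    rw [PushoutI.of_apply_eq_base, hb]
  · rintro ⟨b, rfl⟩
    rw [PushoutI.of_apply_eq_base, ← PushoutI.of_apply_eq_base φ j]
    exact ⟨_, rfl⟩

/-- The stabilizer of the edge `δ A`, a conjugate of the amalgamated subgroup. -/
theorem amalgamStab_inf_coset (hφ : ∀ i, Function.Injective (φ i)) {i j : Fin 2} (hij : i ≠ j)
    (δ : PushoutI φ) :
    amalgamStab φ (coset φ i δ) ⊓ amalgamStab φ (coset φ j δ) =
      (φ i).range.map ((MulAut.conj δ).toMonoidHom.comp (PushoutI.of i)) := by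
  have hmem : ∀ k γ, γ ∈ amalgamStab φ (coset φ k δ) ↔ δ⁻¹ * γ * δ ∈ factor φ k := fun k γ => by
    rw [mem_amalgamStab, smul_coset, eq_comm, coset_eq_iff, mul_assoc]
  ext γ
  rw [Subgroup.mem_inf, hmem, hmem]
  constructor
  · rintro ⟨⟨a, ha⟩, h⟩
    rw [← ha, of_mem_factor_iff hφ hij] at h
    refine ⟨a, h, ?_⟩
    simp only [MonoidHom.comp_apply, ha]
    simp [mul_assoc]
  · rintro ⟨a, ha, rfl⟩
    have h1 : δ⁻¹ * ((MulAut.conj δ).toMonoidHom.comp (PushoutI.of i)) a * δ =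
        PushoutI.of (φ := φ) i a := by
      simp [mul_assoc]
    rw [h1]
    exact ⟨⟨a, rfl⟩, (of_mem_factor_iff hφ hij a).2 ha⟩

/-- If the amalgamated subgroup is its own left quasi-normalizer, then the stabilizer of an edge at
`v` has only infinite orbits on the other vertices of the link of `v`. -/
theorem infinite_orbit_of_leftQuasiNormalizer (hφ : ∀ i, Function.Injective (φ i))
    {v w w' : Vertex φ}
    (hq : leftQuasiNormalizer (φ v.1).range = ((φ v.1).range : Set (Γ v.1)))
    (hw : (bassSerreTree φ).Adj v w) (hw' : (bassSerreTree φ).Adj v w') (hne : w' ≠ w) :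
    {u | ∃ k ∈ amalgamStab φ v ⊓ amalgamStab φ w, u = k • w'}.Infinite := by
  obtain ⟨hij, δ, hv, hwδ⟩ := adj_iff.1 hw
  obtain ⟨hij', δ', hv', hwδ'⟩ := adj_iff.1 hw'
  have hj : w'.1 = w.1 := by omega
  rw [hj] at hwδ'
  obtain ⟨g, hg⟩ := coset_eq_iff.1 (hv.symm.trans hv')
  -- Up to translation by `δ`, the vertices `v`, `w` and `w'` are the cosets of `1`, `1` and `g`, so
  -- that the stabilizer of `w'` in the amalgamated subgroup is its intersection with a conjugate.
  have hδ' : δ' = δ * PushoutI.of v.1 g := by rw [hg, mul_inv_cancel_left]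
  intro hfin
  set K := amalgamStab φ v ⊓ amalgamStab φ w with hK
  have hKmap : K = (φ v.1).range.map ((MulAut.conj δ).toMonoidHom.comp (PushoutI.of v.1)) := by
    rw [← amalgamStab_inf_coset hφ hij δ, ← hv, ← hwδ]
  have h1 := relIndex_stabilizer_ne_zero hfin
  rw [hKmap, ← Subgroup.relIndex_comap] at h1
  have h2 : (MulAction.stabilizer (PushoutI φ) w').comap
      ((MulAut.conj δ).toMonoidHom.comp (PushoutI.of v.1)) =
      (φ v.1).range.map (MulAut.conj g).toMonoidHom := by
    ext a
    rw [Subgroup.mem_comap, MulAction.mem_stabilizer_iff, hwδ', smul_coset, eq_comm, coset_eq_iff,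
      hδ', Subgroup.mem_map_equiv, ← of_mem_factor_iff hφ hij]
    simp [mul_assoc]
  rw [h2] at h1
  have h3 : g ∈ leftQuasiNormalizer (φ v.1).range := h1
  rw [hq] at h3
  refine hne ?_
  rw [hwδ, hwδ', eq_comm, coset_eq_iff, ← hg]
  exact (of_mem_factor_iff hφ hij g).2 h3

variable (hφ : ∀ i, Function.Injective (φ i)) {G : Fin 2 → Type*} [∀ i, Group (G i)]
  (π : ∀ i, Γ i →* G i) {v : Vertex φ} {γv : PushoutI φ} (hγv : γv • v = coset φ v.1 1)

theorem exists_of_eq_conj (hγv : γv • v = coset φ v.1 1) (γ : amalgamStab φ v) :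
    ∃ a : Γ v.1, PushoutI.of (φ := φ) v.1 a = γv * γ * γv⁻¹ := by
  have : γv * γ * γv⁻¹ ∈ factor φ v.1 := by
    rw [← map_conj_amalgamStab hγv]
    exact Subgroup.mem_map_of_mem _ γ.2
  exact this

theorem range_vertexHom : (vertexHom hφ π v γv hγv).range = (π v.1).range := by
  ext z
  constructor
  · rintro ⟨γ, rfl⟩
    obtain ⟨a, ha⟩ := exists_of_eq_conj hγv γ
    exact ⟨a, (of_vertexHom_arg hφ π v γv hγv γ a ha).symm⟩
  · rintro ⟨a, rfl⟩
    have hmem : γv⁻¹ * PushoutI.of v.1 a * γv ∈ amalgamStab φ v := by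
      rw [mem_amalgamStab, mul_smul, mul_smul, hγv, smul_coset, mul_one, inv_smul_eq_iff, hγv,
        eq_comm, coset_eq_iff]
      simp
    exact ⟨⟨_, hmem⟩, of_vertexHom_arg hφ π v γv hγv _ a (by simp [mul_assoc])⟩

theorem finite_ker_vertexHom (hker : Finite (π v.1).ker) :
    Finite (vertexHom hφ π v γv hγv).ker := by
  choose a ha using exists_of_eq_conj hγv
  have hak : ∀ γ : (vertexHom hφ π v γv hγv).ker, a γ.1 ∈ (π v.1).ker := fun γ => by
    rw [MonoidHom.mem_ker, ← of_vertexHom_arg hφ π v γv hγv γ.1 _ (ha γ.1)]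
    exact γ.2
  refine Finite.of_injective (fun γ => (⟨a γ.1, hak γ⟩ : (π v.1).ker)) fun γ γ' h => ?_
  have h1 := congrArg (fun z : (π v.1).ker => PushoutI.of (φ := φ) v.1 z.1) h
  simp only [ha, mul_left_inj, mul_right_inj] at h1
  exact Subtype.ext (Subtype.ext h1)

/-- The homomorphism `π_v` sends the stabilizer of an edge at `v` to a conjugate of the image of the
amalgamated subgroup under an element of the image of the factor. -/
theorem exists_range_vertexHom_edge {w : Vertex φ} (hw : (bassSerreTree φ).Adj v w) :
    ∃ h : Γ v.1, ((vertexHom hφ π v γv hγv).comp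
      (Subgroup.inclusion (inf_le_left : amalgamStab φ v ⊓ amalgamStab φ w ≤ _))).range =
        ((φ v.1).range.map (π v.1)).map (MulAut.conj (π v.1 h)).toMonoidHom := by
  obtain ⟨hij, δ, hv, hwδ⟩ := adj_iff.1 hw
  have h0 : coset φ v.1 1 = coset φ v.1 (γv * δ) := by rw [← smul_coset, ← hv, hγv]
  obtain ⟨h, hh⟩ := coset_eq_iff.1 h0
  rw [inv_one, one_mul] at hh
  have hKmap : amalgamStab φ v ⊓ amalgamStab φ w =
      (φ v.1).range.map ((MulAut.conj δ).toMonoidHom.comp (PushoutI.of v.1)) := by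
    rw [← amalgamStab_inf_coset hφ hij δ, ← hv, ← hwδ]
  have key : ∀ (γ : amalgamStab φ v) (a : Γ v.1),
      (γ : PushoutI φ) = (MulAut.conj δ).toMonoidHom.comp (PushoutI.of v.1) a →
        vertexHom hφ π v γv hγv γ = π v.1 h * π v.1 a * (π v.1 h)⁻¹ := fun γ a hγ => by
    rw [of_vertexHom_arg hφ π v γv hγv γ (h * a * h⁻¹), map_mul, map_mul, map_inv]
    rw [hγ, map_mul, map_mul, map_inv, hh]
    simp [mul_assoc]
  refine ⟨h, ?_⟩
  ext z
  constructor
  · rintro ⟨γ, rfl⟩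
    obtain ⟨a, ha, hγ⟩ := (SetLike.ext_iff.1 hKmap γ.1).1 γ.2
    exact ⟨_, ⟨a, ha, rfl⟩, (key (Subgroup.inclusion inf_le_left γ) a hγ.symm).symm⟩
  · rintro ⟨_, ⟨a, ha, rfl⟩, rfl⟩
    have hmem : (MulAut.conj δ).toMonoidHom.comp (PushoutI.of v.1) a ∈
        amalgamStab φ v ⊓ amalgamStab φ w := by
      rw [hKmap]
      exact ⟨a, ha, rfl⟩
    exact ⟨⟨_, hmem⟩, key (Subgroup.inclusion inf_le_left ⟨_, hmem⟩) a rfl⟩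

end Tree

/-! ### The conditions on indices and normal subgroups, up to conjugation -/

section Conditions

variable {Γ G : Type*} [Group Γ] [Group G]

theorem map_conj_inv_map_conj (a : G) (B : Subgroup G) :
    (B.map (MulAut.conj a).toMonoidHom).map (MulAut.conj a⁻¹).toMonoidHom = B := by
  rw [Subgroup.map_map]
  ext z
  simp [Subgroup.mem_map, mul_assoc]

theorem map_conj_of_mem {a : G} {B : Subgroup G} (ha : a ∈ B) :
    B.map (MulAut.conj a).toMonoidHom = B := by
  ext z
  rw [Subgroup.mem_map_equiv]
  simp only [MulAut.conj_symm_apply]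
  rw [mul_mem_cancel_right ha, mul_mem_cancel_left (inv_mem ha)]

theorem commensurable_map_conj {B D : Subgroup G} (a : G) (h : B.Commensurable D) :
    (B.map (MulAut.conj a).toMonoidHom).Commensurable (D.map (MulAut.conj a).toMonoidHom) := by
  have := (MulAut.conj a).injective
  constructor
  · rw [Subgroup.relIndex_map_map_of_injective _ _ this]
    exact h.1
  · rw [Subgroup.relIndex_map_map_of_injective _ _ this]
    exact h.2

theorem natCast_le_ofReal_mul {p q : ℕ} {d : ℝ} (hd : 0 ≤ d) (hq : q ≠ 0)
    (h : (p : ℝ) / q ≤ d) : (p : ℝ≥0∞) ≤ ENNReal.ofReal d * q := by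
  rw [div_le_iff₀ (by positivity)] at h
  rw [← ENNReal.ofReal_natCast p, ← ENNReal.ofReal_natCast q, ← ENNReal.ofReal_mul hd]
  exact ENNReal.ofReal_le_ofReal h

theorem ConditionV.exists_le {π : Γ →* G} (hV : ConditionV π) : ∃ M : ℝ≥0∞, M ≠ ∞ ∧
    ∀ Δ : Subgroup G, π.range.Commensurable Δ →
      (π.range.relIndex Δ : ℝ≥0∞) ≤ M * Δ.relIndex π.range := by
  obtain ⟨c, hc, h⟩ := hV
  exact ⟨ENNReal.ofReal c, ENNReal.ofReal_ne_top, fun Δ hΔ =>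
    natCast_le_ofReal_mul hc.le hΔ.2 (h Δ hΔ.symm)⟩

/-- Condition (E) also bounds the indices relative to the conjugates of the image of `A` under the
image of `Γ`. -/
theorem ConditionE.exists_le {A : Subgroup Γ} {π : Γ →* G} (hE : ConditionE A π) :
    ∃ M : ℝ≥0∞, M ≠ ∞ ∧ ∀ (h : Γ) (Δ Δ₀ : Subgroup G), π.range.Commensurable Δ → Δ₀ ≤ Δ →
      ((A.map π).map (MulAut.conj (π h)).toMonoidHom).Commensurable Δ₀ →
        (((A.map π).map (MulAut.conj (π h)).toMonoidHom).relIndex Δ₀ : ℝ≥0∞) ≤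
          M * Δ₀.relIndex ((A.map π).map (MulAut.conj (π h)).toMonoidHom) := by
  obtain ⟨d, hd, hE⟩ := hE
  refine ⟨ENNReal.ofReal d, ENNReal.ofReal_ne_top, fun h Δ Δ₀ hΔ hle hΔ₀ => ?_⟩
  refine natCast_le_ofReal_mul hd.le hΔ₀.2 ?_
  have h1 := commensurable_map_conj (π h)⁻¹ hΔ
  rw [map_conj_of_mem (inv_mem (MonoidHom.mem_range.2 ⟨h, rfl⟩))] at h1
  have h2 := commensurable_map_conj (π h)⁻¹ hΔ₀
  rw [map_conj_inv_map_conj] at h2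
  have h3 := hE _ h1.symm _ (Subgroup.map_mono hle) h2.symm
  have hinj : Function.Injective (MulAut.conj (π h)⁻¹).toMonoidHom :=
    (MulAut.conj (π h)⁻¹).injective
  rw [← Subgroup.relIndex_map_map_of_injective Δ₀ _ hinj,
    ← Subgroup.relIndex_map_map_of_injective _ Δ₀ hinj, map_conj_inv_map_conj]
  exact h3

theorem ConditionF.eq_bot {A : Subgroup Γ} {π : Γ →* G} (hF : ConditionF A π) (h : Γ)
    {Δ Δ₀ N : Subgroup G} (hΔ : π.range.Commensurable Δ) (hle : Δ₀ ≤ Δ)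
    (hΔ₀ : ((A.map π).map (MulAut.conj (π h)).toMonoidHom).Commensurable Δ₀) (hN : N ≤ Δ₀)
    (hfin : Finite N) (hnorm : ∀ d ∈ Δ₀, ∀ n ∈ N, d * n * d⁻¹ ∈ N) : N = ⊥ := by
  have h1 := commensurable_map_conj (π h)⁻¹ hΔ
  rw [map_conj_of_mem (inv_mem (MonoidHom.mem_range.2 ⟨h, rfl⟩))] at h1
  have h2 := commensurable_map_conj (π h)⁻¹ hΔ₀
  rw [map_conj_inv_map_conj] at h2
  set f := (MulAut.conj (π h)⁻¹).toMonoidHom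
  have hfN : Finite (N.map f) := Finite.of_surjective _ (f.subgroupMap_surjective N)
  have h3 := hF _ h1.symm _ (Subgroup.map_mono hle) h2.symm ((N.map f).subgroupOf (Δ₀.map f))
    ⟨by
      rintro ⟨_, n', hn', rfl⟩ hn ⟨_, d, hd, rfl⟩
      obtain ⟨n, hn, hnn⟩ := Subgroup.mem_subgroupOf.1 hn
      refine Subgroup.mem_subgroupOf.2 ⟨d * n * d⁻¹, hnorm d hd n hn, ?_⟩
      rw [map_mul, map_mul, map_inv, hnn]
      rfl⟩
    (Finite.of_injective (fun x => (⟨x.1.1, x.2⟩ : N.map f)) fun x y hxy =>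
      Subtype.ext (Subtype.ext (congrArg (fun z : N.map f => z.1) hxy)))
  rw [Subgroup.subgroupOf_eq_bot, disjoint_iff, inf_eq_left.2 (Subgroup.map_mono hN)] at h3
  exact (Subgroup.map_eq_bot_iff_of_injective N (MulAut.conj (π h)⁻¹).injective).1 h3

end Conditions

/-! ### Couplings and atomic maps in terms of weights -/

section FundamentalDomain

variable {H S : Type*} [Group H] [MulAction H S] [MeasurableSpace S] {m : Measure S}

open Pointwise in
theorem isWeight_of_isFundamentalDomain [Countable H] {Y : Set S} (hYm : MeasurableSet Y)
    (hY : IsFundamentalDomain H Y m) : IsWeight H m Set.univ (Y.indicator 1) := by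
  refine ⟨measurable_one.indicator hYm, ?_⟩
  have h2 : ∀ᵐ x ∂m, ∀ g g' : H, g ≠ g' → ¬ (x ∈ g • Y ∧ x ∈ g' • Y) := by
    refine ae_all_iff.2 fun g => ae_all_iff.2 fun g' => ?_
    by_cases hg : g = g'
    · simp [hg]
    · have := measure_eq_zero_iff_ae_notMem.1 (hY.aedisjoint hg)
      filter_upwards [this] with x hx _ hx'
      exact hx hx'
  filter_upwards [hY.ae_covers, h2] with x ⟨g, hg⟩ hx _
  rw [tsum_eq_single g, Set.indicator_of_mem hg, Pi.one_apply]
  intro g' hg'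
  refine Set.indicator_of_notMem (fun hmem => ?_) _
  refine hx g⁻¹ g'⁻¹ (fun h => hg' (inv_injective h).symm) ⟨?_, ?_⟩
  · rwa [Set.mem_smul_set_iff_inv_smul_mem, inv_inv]
  · rwa [Set.mem_smul_set_iff_inv_smul_mem, inv_inv]

/-- A coupling, described by weights. -/
theorem IsCoupling.exists_isSubcoupling {Γ Λ : Type*} [Group Γ] [Group Λ] [Countable Γ]
    [Countable Λ] [MulAction (Γ × Λ) S] [MulAction Γ S] [MulAction Λ S]
    (hΓ : ∀ (γ : Γ) (x : S), ((γ, 1) : Γ × Λ) • x = γ • x)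
    (hΛ : ∀ (l : Λ) (x : S), ((1, l) : Γ × Λ) • x = l • x)
    [MeasurableConstSMul Γ S] [SMulInvariantMeasure Γ S m] (hm : IsCoupling Γ Λ m) :
    ∃ κ ℓ : ℝ≥0∞, κ ≠ 0 ∧ κ ≠ ∞ ∧ ℓ ≠ ∞ ∧
      IsSubcoupling m (⊤ : Subgroup Γ) (⊤ : Subgroup Λ) Set.univ κ ℓ := by
  obtain ⟨Y, hYm, hY, hYfin⟩ := hm.exists_left
  obtain ⟨X, hXm, hX, hXfin⟩ := hm.exists_right
  have : Countable (MonoidHom.inl Γ Λ).range :=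
    (MonoidHom.inl Γ Λ).rangeRestrict_surjective.countable
  have : Countable (MonoidHom.inr Γ Λ).range :=
    (MonoidHom.inr Γ Λ).rangeRestrict_surjective.countable
  have wY := (isWeight_of_isFundamentalDomain hYm hY).congr_equiv (H' := (⊤ : Subgroup Γ))
    (Subgroup.topEquiv.toEquiv.trans (MonoidHom.ofInjective
      (f := MonoidHom.inl Γ Λ) (fun _ _ h => congrArg Prod.fst h)).toEquiv)
    (fun γ x => hΓ γ.1 x)
  have wX := (isWeight_of_isFundamentalDomain hXm hX).congr_equiv (H' := (⊤ : Subgroup Λ))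
    (Subgroup.topEquiv.toEquiv.trans (MonoidHom.ofInjective
      (f := MonoidHom.inr Γ Λ) (fun _ _ h => congrArg Prod.snd h)).toEquiv)
    (fun l x => hΛ l.1 x)
  have hint : ∀ Z : Set S, MeasurableSet Z →
      ∫⁻ x in Set.univ, Z.indicator (1 : S → ℝ≥0∞) x ∂m = m Z := fun Z hZ => by
    rw [Measure.restrict_univ, lintegral_indicator_one hZ]
  refine ⟨m Y, m X, fun h0 => hm.ne_zero ?_, hYfin.ne, hXfin.ne, MeasurableSet.univ,
    fun h => by simp, fun h => by simp, ⟨_, wY, hint Y hYm⟩, ⟨_, wX, hint X hXm⟩⟩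
  have h1 := wY.measure_eq MeasurableSet.univ (fun h => by simp)
  rwa [hint Y hYm, h0, mul_zero, Measure.measure_univ_eq_zero] at h1

end FundamentalDomain

section AtomicMap

theorem conj_mem_map_ker {H G : Type*} [Group H] [Group G] {L : Subgroup H} (β : L →* G) :
    ∀ l ∈ L, ∀ n ∈ β.ker.map L.subtype, l * n * l⁻¹ ∈ β.ker.map L.subtype := by
  rintro l hl _ ⟨n, hn, rfl⟩
  exact ⟨⟨l, hl⟩ * n * ⟨l, hl⟩⁻¹, Subgroup.Normal.conj_mem inferInstance n hn _, rfl⟩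

theorem range_comp_inclusion_le {H G : Type*} [Group H] [Group G] {L L' : Subgroup H} (hL : L' ≤ L)
    (β : L →* G) : (β.comp (Subgroup.inclusion hL)).range ≤ β.range := by
  rintro _ ⟨l, rfl⟩
  exact ⟨_, rfl⟩

theorem finite_ker_comp_inclusion {H G : Type*} [Group H] [Group G] {L L' : Subgroup H}
    (hL : L' ≤ L) (β : L →* G) [Finite β.ker] : Finite (β.comp (Subgroup.inclusion hL)).ker ∧
      Nat.card (β.comp (Subgroup.inclusion hL)).ker ≤ Nat.card β.ker := by
  have hinj : Function.Injective (fun l : (β.comp (Subgroup.inclusion hL)).ker =>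
      (⟨Subgroup.inclusion hL l.1, l.2⟩ : β.ker)) := fun l l' h =>
    Subtype.ext (Subgroup.inclusion_injective hL (congrArg Subtype.val h))
  exact ⟨Finite.of_injective _ hinj, Nat.card_le_card_of_injective _ hinj⟩

variable {Γ Λ S G : Type*} [Group Γ] [Group Λ] [MulAction Γ S] [MulAction Λ S]
  [MeasurableSpace S] [Group G] [MeasurableSpace G] {m : Measure S}

/-- A Borel map `Ψ` to the group `G` that on `E` is almost equivariant and takes almost all of its
values in a countable set; the kernel of the homomorphism on the left side is finite. -/
structure IsAtomicMap (m : Measure S) {K : Subgroup Γ} {L : Subgroup Λ} (E : Set S) (α : K →* G)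
    (β : L →* G) (Ψ : S → G) : Prop where
  measurable : Measurable Ψ
  left : ∀ k : K, ∀ᵐ x ∂m, x ∈ E → Ψ (k • x) = α k * Ψ x
  right : ∀ l : L, ∀ᵐ x ∂m, x ∈ E → Ψ (l • x) = Ψ x * (β l)⁻¹
  finite_ker : Finite α.ker
  atomic : ∃ C : Set G, C.Countable ∧ ∀ᵐ x ∂m, x ∈ E → Ψ x ∈ C

variable {K K' : Subgroup Γ} {L L' : Subgroup Λ} {E E' : Set S} {α : K →* G} {β : L →* G}
  {Ψ : S → G} {κ ℓ : ℝ≥0∞}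

theorem IsAtomicMap.mono (hΨ : IsAtomicMap m E α β Ψ) (hK : K' ≤ K) (hL : L' ≤ L) (hE : E' ⊆ E) :
    IsAtomicMap m E' (α.comp (Subgroup.inclusion hK)) (β.comp (Subgroup.inclusion hL)) Ψ := by
  obtain ⟨h1, h2, h3, h4, C, hC, h5⟩ := hΨ
  refine ⟨h1, fun k => ?_, fun l => ?_, (finite_ker_comp_inclusion hK α).1, C, hC, ?_⟩
  · exact (h2 (Subgroup.inclusion hK k)).mono fun x hx hxE => hx (hE hxE)
  · exact (h3 (Subgroup.inclusion hL l)).mono fun x hx hxE => hx (hE hxE)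
  · exact h5.mono fun x hx hxE => hx (hE hxE)

/-- A coupling of positive covolume has an atom. -/
theorem IsAtomicMap.exists_atom (hΨ : IsAtomicMap m E α β Ψ) (hE : IsSubcoupling m K L E κ ℓ)
    (hκ : κ ≠ 0) : ∃ g, m (E ∩ Ψ ⁻¹' {g}) ≠ 0 := by
  by_contra! h
  obtain ⟨C, hC, hCE⟩ := hΨ.atomic
  have h1 : m (⋃ g ∈ C, E ∩ Ψ ⁻¹' {g}) = 0 := (measure_biUnion_null_iff hC).2 fun g _ => h g
  have h2 : m E = 0 := by
    refine measure_mono_null ?_ (measure_union_null h1 hCE)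
    intro x hx
    by_cases hxC : Ψ x ∈ C
    · exact Or.inl (Set.mem_biUnion hxC ⟨hx, rfl⟩)
    · exact Or.inr fun h => hxC (h hx)
  obtain ⟨w, hw, hwκ⟩ := hE.left_weight
  rw [Measure.restrict_eq_zero.2 h2, lintegral_zero_measure] at hwκ
  exact hκ hwκ.symm

variable [MeasurableConstSMul Γ S] [SMulInvariantMeasure Γ S m] [Countable Γ]
  [MeasurableConstSMul Λ S] [SMulInvariantMeasure Λ S m] [Countable Λ]
  [MeasurableSingletonClass G] [MeasurableInv G]

theorem IsAtomicMap.commensurable (hΨ : IsAtomicMap m E α β Ψ) (hE : IsSubcoupling m K L E κ ℓ)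
    (hκ : κ ≠ ∞) (hℓ : ℓ ≠ ∞) {g : G} (hg : m (E ∩ Ψ ⁻¹' {g}) ≠ 0) :
    Finite β.ker ∧ α.range.Commensurable (β.range.map (MulAut.conj g).toMonoidHom) := by
  obtain ⟨wK, hwK, rfl⟩ := hE.left_weight
  obtain ⟨wL, hwL, rfl⟩ := hE.right_weight
  obtain ⟨h1, h2, _⟩ := atom_comparison hE.measurableSet hΨ.measurable hE.left_inv hwK hE.right_inv
    hwL hΨ.left hΨ.right hκ hℓ hΨ.finite_ker hg
  exact ⟨h1, h2⟩

theorem IsAtomicMap.covolume_le (hΨ : IsAtomicMap m E α β Ψ) (hE : IsSubcoupling m K L E κ ℓ)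
    (hκ : κ ≠ ∞) (hℓ : ℓ ≠ ∞) {M : ℝ≥0∞} {N : ℕ} (hN : Finite β.ker → Nat.card β.ker ≤ N)
    (hM : ∀ g, m (E ∩ Ψ ⁻¹' {g}) ≠ 0 →
      α.range.Commensurable (β.range.map (MulAut.conj g).toMonoidHom) →
      (α.range.relIndex (β.range.map (MulAut.conj g).toMonoidHom) : ℝ≥0∞) ≤
        M * (β.range.map (MulAut.conj g).toMonoidHom).relIndex α.range) :
    κ / (N * M) ≤ ℓ := by
  obtain ⟨wK, hwK, rfl⟩ := hE.left_weight
  obtain ⟨wL, hwL, rfl⟩ := hE.right_weight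
  obtain ⟨C, hC, hCE⟩ := hΨ.atomic
  exact ENNReal.div_le_of_le_mul' (AmalgamME.covolume_le hE.measurableSet hΨ.measurable hE.left_inv
    hwK hE.right_inv hwL hΨ.left hΨ.right hκ hℓ hΨ.finite_ker hC hCE hN hM)

end AtomicMap

/-! ### The parts of the coupling that fix a vertex or an edge -/

section TreeCoupling

variable {A : Type*} {Γ : Fin 2 → Type*} [Group A] [∀ i, Group (Γ i)] {φ : ∀ i, A →* Γ i}
  {Λ S : Type*} [Group Λ] [MulAction (PushoutI φ) S] [MulAction Λ S] [MeasurableSpace S]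
  [MulAction Λ (Vertex φ)]

/-- A coupling of the amalgamated free product, of covolume `κ`, and the group `Λ`, of covolume `ℓ`,
with an almost equivariant Borel map `Φ` to the automorphism group of the tree. -/
structure IsTreeCoupling (m : Measure S) (ρ : Λ →* AutT φ) (Φ : S → AutT φ) (κ ℓ : ℝ≥0∞) :
    Prop where
  smul_eq : ∀ (l : Λ) (v : Vertex φ), l • v = (ρ l).1 v
  total : IsSubcoupling m (⊤ : Subgroup (PushoutI φ)) (⊤ : Subgroup Λ) Set.univ κ ℓ
  perm : IsAlmostEquivariantPerm (PushoutI φ) Λ m fun x => (Φ x).1.toEquiv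
  left_ne_zero : κ ≠ 0
  left_ne_top : κ ≠ ∞
  right_ne_top : ℓ ≠ ∞

variable {m : Measure S} {ρ : Λ →* AutT φ} {Φ : S → AutT φ} {κ ℓ : ℝ≥0∞}

theorem IsTreeCoupling.actingStab_eq (h : IsTreeCoupling m ρ Φ κ ℓ) (v : Vertex φ) :
    actingStab φ ρ v = MulAction.stabilizer Λ v := by
  ext l
  rw [MulAction.mem_stabilizer_iff, h.smul_eq]
  rfl

variable [MeasurableConstSMul (PushoutI φ) S] [SMulInvariantMeasure (PushoutI φ) S m]
  [Countable (PushoutI φ)] [MeasurableConstSMul Λ S] [SMulInvariantMeasure Λ S m] [Countable Λ]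
  [SMulCommClass (PushoutI φ) Λ S]

/-- The part of the coupling fixing the vertex `v`. -/
theorem IsTreeCoupling.vertex (h : IsTreeCoupling m ρ Φ κ ℓ) (v : Vertex φ) : ∃ ℓ' ≤ ℓ,
    IsSubcoupling m (amalgamStab φ v) (actingStab φ ρ v) (smallCoupling φ Φ v) κ ℓ' := by
  obtain ⟨w, hw, hwℓ⟩ := h.total.right_weight
  have := h.total.fix h.perm (U := vertexClass φ v.1)
    (ae_of_all _ fun x _ u => autT_mem_vertexClass (Φ x) v.1 u) exists_smul_of_mem_vertexClass
    (u₀ := v) (u := v) rfl rfl hw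
  rw [top_inf_eq, top_inf_eq, Set.univ_inter, ← h.actingStab_eq, ← amalgamStab_eq] at this
  exact ⟨_, hwℓ ▸ lintegral_mono_set (Set.subset_univ _), this⟩

/-- The part of the coupling fixing the edge between `v` and `u`. -/
theorem IsTreeCoupling.edge (h : IsTreeCoupling m ρ Φ κ ℓ) {v u : Vertex φ}
    (hvu : (bassSerreTree φ).Adj v u) : ∃ ℓ' ≤ ℓ,
    IsSubcoupling m (amalgamStab φ v ⊓ amalgamStab φ u) (actingStab φ ρ v ⊓ actingStab φ ρ u)
      (smallCoupling φ Φ v ∩ smallCoupling φ Φ u) κ ℓ' := by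
  obtain ⟨ℓ', hℓ', hv⟩ := h.vertex v
  obtain ⟨w, hw, hwℓ⟩ := hv.right_weight
  have := hv.fix h.perm (U := (bassSerreTree φ).neighborSet v)
    (ae_of_all _ fun x hx u => autT_mem_neighborSet hx u)
    (fun u hu u' hu' => exists_amalgamStab_smul hu hu') (u₀ := u) (u := u) hvu hvu hw
  rw [← h.actingStab_eq u, ← amalgamStab_eq u] at this
  exact ⟨_, le_trans (hwℓ ▸ lintegral_mono_set Set.inter_subset_left) hℓ', this⟩

section Vertex

variable {v : Vertex φ} {G : Type*} [Group G] [MeasurableSpace G] [MeasurableSingletonClass G]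
  [MeasurableInv G] {π : Γ v.1 →* G} {α : amalgamStab φ v →* G} {β : actingStab φ ρ v →* G}
  {Ψ : S → G}

/-- The homomorphism `α` on the stabilizer of `v` has the same range as `π`, and it sends the edge
stabilizers to conjugates of the image of the amalgamated subgroup. -/
structure IsVertexHom (v : Vertex φ) (π : Γ v.1 →* G) (α : amalgamStab φ v →* G) : Prop where
  range_eq : α.range = π.range
  range_edge : ∀ u, (bassSerreTree φ).Adj v u → ∃ h : Γ v.1, (α.comp (Subgroup.inclusion
    (inf_le_left : amalgamStab φ v ⊓ amalgamStab φ u ≤ _))).range =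
      ((φ v.1).range.map π).map (MulAut.conj (π h)).toMonoidHom

/-- An atom for an edge at `v` is also an atom for `v`, so that the vertex groups are commensurable
there. -/
theorem IsTreeCoupling.edge_commensurable (h : IsTreeCoupling m ρ Φ κ ℓ)
    (hα : IsVertexHom v π α) (hΨ : IsAtomicMap m (smallCoupling φ Φ v) α β Ψ) {u : Vertex φ} {g : G}
    (hg : m ((smallCoupling φ Φ v ∩ smallCoupling φ Φ u) ∩ Ψ ⁻¹' {g}) ≠ 0) :
    Finite β.ker ∧ π.range.Commensurable (β.range.map (MulAut.conj g).toMonoidHom) := by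
  obtain ⟨ℓ', hℓ', hv⟩ := h.vertex v
  rw [← hα.range_eq]
  refine hΨ.commensurable hv h.left_ne_top (ne_top_of_le_ne_top h.right_ne_top hℓ') fun h0 => hg ?_
  exact measure_mono_null (Set.inter_subset_inter_left _ Set.inter_subset_left) h0

theorem IsTreeCoupling.finitelyManyOrbits_link (h : IsTreeCoupling m ρ Φ κ ℓ)
    (hα : IsVertexHom v π α) (hΨ : IsAtomicMap m (smallCoupling φ Φ v) α β Ψ)
    (hE : ConditionE (φ v.1).range π) :
    FinitelyManyOrbits ρ (actingStab φ ρ v) ((bassSerreTree φ).neighborSet v) := by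
  obtain ⟨ℓ', hℓ', hv⟩ := h.vertex v
  have hℓ'top := ne_top_of_le_ne_top h.right_ne_top hℓ'
  obtain ⟨M, hM, hE⟩ := hE.exists_le
  have hfin := hv.finite_orbits h.perm (U := (bassSerreTree φ).neighborSet v)
    (ae_of_all _ fun x hx u => autT_mem_neighborSet hx u)
    (fun u hu u' hu' => exists_amalgamStab_smul hu hu') hℓ'top
    (ε := κ / (Nat.card β.ker * M))
    (ENNReal.div_pos h.left_ne_zero (ENNReal.mul_ne_top (ENNReal.natCast_ne_top _) hM))
    (fun u hu ℓ'' hℓ'' hvu => by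
      rw [← h.actingStab_eq u, ← amalgamStab_eq u] at hvu
      have hvu' : IsSubcoupling m (amalgamStab φ v ⊓ amalgamStab φ u)
        (actingStab φ ρ v ⊓ actingStab φ ρ u)
        (smallCoupling φ Φ v ∩ smallCoupling φ Φ u) κ ℓ'' := hvu
      have hΨ' := hΨ.mono (inf_le_left : amalgamStab φ v ⊓ amalgamStab φ u ≤ _)
        (inf_le_left : actingStab φ ρ v ⊓ actingStab φ ρ u ≤ _)
        (Set.inter_subset_left : smallCoupling φ Φ v ∩ smallCoupling φ Φ u ⊆ _)
      obtain ⟨t, ht⟩ := hα.range_edge u hu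
      refine hΨ'.covolume_le hvu' h.left_ne_top (ne_top_of_le_ne_top hℓ'top hℓ'') ?_ ?_
      · intro _
        obtain ⟨g, hg⟩ := hΨ'.exists_atom hvu' h.left_ne_zero
        have := (h.edge_commensurable hα hΨ hg).1
        exact (finite_ker_comp_inclusion inf_le_left β).2
      · intro g hg hcomm
        rw [ht] at hcomm ⊢
        exact hE t _ _ (h.edge_commensurable hα hΨ hg).2
          (Subgroup.map_mono (range_comp_inclusion_le _ _)) hcomm)
  refine hfin.subset ?_
  rintro O ⟨u, hu, rfl⟩
  refine ⟨u, hu, ?_⟩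
  simp only [h.smul_eq]
  rfl

/-- Condition (F) at `v`: a finite subgroup of `Λ` that is normalized by the stabilizer of an edge
at `v` and contained in it is killed by the homomorphism at `v`. -/
theorem IsTreeCoupling.le_ker_of_conditionF (h : IsTreeCoupling m ρ Φ κ ℓ)
    (hα : IsVertexHom v π α) (hΨ : IsAtomicMap m (smallCoupling φ Φ v) α β Ψ)
    (hF : ConditionF (φ v.1).range π) {u : Vertex φ} (hvu : (bassSerreTree φ).Adj v u)
    {N : Subgroup Λ} (hfin : Finite N) (hN : N ≤ actingStab φ ρ v ⊓ actingStab φ ρ u)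
    (hnorm : ∀ l ∈ actingStab φ ρ v ⊓ actingStab φ ρ u, ∀ n ∈ N, l * n * l⁻¹ ∈ N) :
    N ≤ β.ker.map (actingStab φ ρ v).subtype := by
  obtain ⟨ℓ', hℓ', he⟩ := h.edge hvu
  have hΨ' := hΨ.mono (inf_le_left : amalgamStab φ v ⊓ amalgamStab φ u ≤ _)
    (inf_le_left : actingStab φ ρ v ⊓ actingStab φ ρ u ≤ _)
    (Set.inter_subset_left : smallCoupling φ Φ v ∩ smallCoupling φ Φ u ⊆ _)
  obtain ⟨t, ht⟩ := hα.range_edge u hvu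
  obtain ⟨g, hg⟩ := hΨ'.exists_atom he h.left_ne_zero
  have hcomm := (hΨ'.commensurable he h.left_ne_top
    (ne_top_of_le_ne_top h.right_ne_top hℓ') hg).2
  set β' := β.comp (Subgroup.inclusion
    (inf_le_left : actingStab φ ρ v ⊓ actingStab φ ρ u ≤ _)) with hβ'
  rw [ht] at hcomm
  let f := (MulAut.conj g).toMonoidHom.comp β'
  let R := N.subgroupOf (actingStab φ ρ v ⊓ actingStab φ ρ u)
  have hR : Finite R := Finite.of_injective (fun x => (⟨x.1.1, x.2⟩ : N)) fun x y hxy =>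
    Subtype.ext (Subtype.ext (congrArg (fun z : N => z.1) hxy))
  have hrange : β'.range.map (MulAut.conj g).toMonoidHom = f.range := MonoidHom.map_range _ _
  have hbot := hF.eq_bot t (N := R.map f) (h.edge_commensurable hα hΨ hg).2
    (Subgroup.map_mono (range_comp_inclusion_le _ _)) hcomm
    (by rw [hrange]; exact Subgroup.map_le_range f R)
    (Finite.of_surjective _ (f.subgroupMap_surjective R))
    (by
      rw [hrange]
      rintro _ ⟨l, rfl⟩ _ ⟨n, hn, rfl⟩
      refine ⟨l * n * l⁻¹, hnorm l.1 l.2 n.1 hn, ?_⟩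
      rw [map_mul, map_mul, map_inv])
  intro n hn
  have h1 : f ⟨n, hN hn⟩ = 1 := by
    have : f ⟨n, hN hn⟩ ∈ R.map f := ⟨⟨n, hN hn⟩, hn, rfl⟩
    rwa [hbot, Subgroup.mem_bot] at this
  have h2 : β' ⟨n, hN hn⟩ = 1 := (MulAut.conj g).injective (h1.trans (map_one _).symm)
  exact ⟨⟨n, (hN hn).1⟩, h2, rfl⟩

end Vertex

/-- Suppose that `A` equals its left quasi-normalizer in the factor belonging to `v`. A finite
normal subgroup of the stabilizer of `v` in `Λ` fixes the link of `v`: the stabilizer of a vertex of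
the link has only infinite orbits on the rest of the link. -/
theorem IsTreeCoupling.le_actingStab_of_adj (h : IsTreeCoupling m ρ Φ κ ℓ)
    (hφ : ∀ i, Function.Injective (φ i)) {v u : Vertex φ}
    (hq : leftQuasiNormalizer (φ v.1).range = ((φ v.1).range : Set (Γ v.1)))
    (hvu : (bassSerreTree φ).Adj v u) {N : Subgroup Λ} (hfin : Finite N)
    (hN : N ≤ actingStab φ ρ v) (hnorm : ∀ l ∈ actingStab φ ρ v, ∀ n ∈ N, l * n * l⁻¹ ∈ N) :
    N ≤ actingStab φ ρ u := by
  have : Countable (Vertex φ) := countable_vertex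
  intro n hn
  rw [h.actingStab_eq, MulAction.mem_stabilizer_iff]
  by_contra hne
  have hadj : ∀ l ∈ actingStab φ ρ v, ∀ w, (bassSerreTree φ).Adj v w →
      (bassSerreTree φ).Adj v (l • w) := fun l hl w hw => by
    have hv : (ρ l).1 v = v := hl
    have := (ρ l).1.map_adj_iff (v := v) (w := w)
    rw [hv] at this
    rw [h.smul_eq]
    exact this.2 hw
  obtain ⟨ℓ', hℓ', he⟩ := h.edge hvu
  have hinf := he.infinite_orbit h.perm h.left_ne_zero (ne_top_of_le_ne_top h.right_ne_top hℓ')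
    (Y := {w | (bassSerreTree φ).Adj v w ∧ w ≠ u})
    (fun w hw => infinite_orbit_of_leftQuasiNormalizer hφ hq hvu hw.1 hw.2) (u := n • u)
    (ae_of_all _ fun x hx l hl => by
      refine ⟨(autT_mem_neighborSet hx.1 _).2 (hadj l hl.1 _ (hadj n (hN hn) u hvu)), fun hc => ?_⟩
      have hu : (Φ x).1.toEquiv u = u := hx.2
      have hl' : l • u = u := by
        rw [h.smul_eq]
        exact hl.2
      have h1 := (Φ x).1.toEquiv.injective (hc.trans hu.symm)
      rw [← hl', smul_left_cancel_iff, hl'] at h1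
      exact hne h1)
  -- Since `L` fixes `u` and normalizes `N`, the orbit of `n • u` lies in the finite orbit `N • u`.
  refine hinf ((Set.finite_range fun n : N => (n : Λ) • u).subset ?_)
  rintro _ ⟨l, hl, rfl⟩
  have hl' : l⁻¹ • u = u := by
    rw [h.smul_eq]
    exact inv_mem (S := Subgroup Λ) hl.2
  refine ⟨⟨l * n * l⁻¹, hnorm l hl.1 n hn⟩, ?_⟩
  change (l * n * l⁻¹) • u = _
  rw [mul_smul, hl', mul_smul]

end TreeCoupling

/-! ### Representatives of orbits and cocompactness -/

section Orbits

variable {A : Type*} {Γ : Fin 2 → Type*} [Group A] [∀ i, Group (Γ i)] {φ : ∀ i, A →* Γ i}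
  {Λ : Type*} [Group Λ] {ρ : Λ →* AutT φ}

theorem FinitelyManyOrbits.exists_representatives {H : Subgroup Λ} {U : Set (Vertex φ)}
    (h : FinitelyManyOrbits ρ H U) :
    ∃ R : Set (Vertex φ), R.Finite ∧ R ⊆ U ∧ ∀ u ∈ U, ∃ r ∈ R, ∃ l ∈ H, u = ρ l • r := by
  choose! f hf hfO using fun (O : Set (Vertex φ))
    (hO : ∃ u ∈ U, O = {w | ∃ l ∈ H, w = ρ l • u}) => hO
  refine ⟨_, h.image f, ?_, fun u hu => ?_⟩
  · rintro _ ⟨O, hO, rfl⟩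
    exact hf O hO
  · have hO : ∃ u' ∈ U, {w | ∃ l ∈ H, w = ρ l • u} = {w | ∃ l ∈ H, w = ρ l • u'} := ⟨u, hu, rfl⟩
    refine ⟨_, ⟨_, hO, rfl⟩, ?_⟩
    have h1 : u ∈ {w | ∃ l ∈ H, w = ρ l • u} := ⟨1, one_mem _, by rw [map_one, one_smul]⟩
    rw [hfO _ hO] at h1
    exact h1

theorem isCocompact_of_finitelyManyOrbits
    (hV : ∀ i, FinitelyManyOrbits ρ ⊤ (vertexClass φ i))
    (hE : ∀ v, FinitelyManyOrbits ρ (actingStab φ ρ v) ((bassSerreTree φ).neighborSet v)) :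
    IsCocompact ρ := by
  constructor
  · refine ((hV 0).union (hV 1)).subset ?_
    rintro _ ⟨u, -, rfl⟩
    have hi : u.1 = 0 ∨ u.1 = 1 := by omega
    rcases hi with hi | hi
    · exact Or.inl ⟨u, hi, rfl⟩
    · exact Or.inr ⟨u, hi, rfl⟩
  · obtain ⟨R, hR, -, hR'⟩ := (hV 0).exists_representatives
    choose Q hQ hQv hQ' using fun v => (hE v).exists_representatives
    have hfin : (⋃ r ∈ R, (fun q => s(r, q)) '' Q r).Finite :=
      hR.biUnion fun r _ => (hQ r).image _
    refine (hfin.image fun e => {e' | ∃ l : Λ, e' = e.map (fun v => ρ l • v)}).subset ?_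
    -- Each edge is a translate of an edge between chosen representatives.
    have key : ∀ u w, (bassSerreTree φ).Adj u w → u.1 = 0 → ∃ r ∈ R, ∃ q ∈ Q r, ∃ l : Λ,
        u = ρ l • r ∧ w = ρ l • q := by
      intro u w huw hu
      obtain ⟨r, hr, l, -, rfl⟩ := hR' u hu
      have hadj : (bassSerreTree φ).Adj r ((ρ l)⁻¹ • w) := by
        have := (ρ l)⁻¹.1.map_adj_iff.2 huw
        have h1 : (ρ l)⁻¹.1 (ρ l • r) = r := inv_smul_smul (ρ l) r
        rw [h1] at this
        exact this
      obtain ⟨q, hq, l', hl', hw⟩ := hQ' r _ hadj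
      refine ⟨r, hr, q, hq, l * l', ?_, ?_⟩
      · have : ρ l' • r = r := hl'
        rw [map_mul, mul_smul, this]
      · rw [map_mul, mul_smul, ← hw, smul_inv_smul]
    rintro _ ⟨e, he, rfl⟩
    have hex : ∃ r ∈ R, ∃ q ∈ Q r, ∃ l : Λ, e = s(r, q).map (fun v => ρ l • v) := by
      induction e using Sym2.ind with
      | _ u w =>
        have huw : (bassSerreTree φ).Adj u w := he
        have hi : u.1 = 0 ∨ w.1 = 0 := by
          have := (adj_iff.1 huw).1
          omega
        rcases hi with hi | hi
        · obtain ⟨r, hr, q, hq, l, rfl, rfl⟩ := key u w huw hi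
          exact ⟨r, hr, q, hq, l, rfl⟩
        · obtain ⟨r, hr, q, hq, l, rfl, rfl⟩ := key w u huw.symm hi
          exact ⟨r, hr, q, hq, l, Sym2.eq_swap⟩
    obtain ⟨r, hr, q, hq, l, rfl⟩ := hex
    refine ⟨s(r, q), Set.mem_biUnion hr ⟨q, hq, rfl⟩, ?_⟩
    ext e'
    simp only [Set.mem_ofPred_eq, Sym2.map_map, Function.comp_def, ← mul_smul, ← map_mul]
    constructor
    · rintro ⟨t, rfl⟩
      exact ⟨t * l⁻¹, by rw [inv_mul_cancel_right]⟩
    · rintro ⟨t, rfl⟩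
      exact ⟨t * l, rfl⟩

end Orbits

/-! ### Boundedness of the kernels -/

section Kernels

variable {A : Type*} {Γ : Fin 2 → Type*} [Group A] [∀ i, Group (Γ i)] {φ : ∀ i, A →* Γ i}
  {Λ S : Type*} [Group Λ] [MulAction (PushoutI φ) S] [MulAction Λ S] [MeasurableSpace S]
  [MulAction Λ (Vertex φ)] {m : Measure S} {ρ : Λ →* AutT φ} {Φ : S → AutT φ} {κ ℓ : ℝ≥0∞}
  [MeasurableConstSMul (PushoutI φ) S] [SMulInvariantMeasure (PushoutI φ) S m]
  [Countable (PushoutI φ)] [MeasurableConstSMul Λ S] [SMulInvariantMeasure Λ S m] [Countable Λ]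
  [SMulCommClass (PushoutI φ) Λ S]
  {G : Fin 2 → Type*} [∀ i, Group (G i)] [∀ i, MeasurableSpace (G i)]
  [∀ i, MeasurableSingletonClass (G i)] [∀ i, MeasurableInv (G i)] {π : ∀ i, Γ i →* G i}
  {α : ∀ v : Vertex φ, amalgamStab φ v →* G v.1} {β : ∀ v : Vertex φ, actingStab φ ρ v →* G v.1}
  {Ψ : ∀ v : Vertex φ, S → G v.1}

theorem IsTreeCoupling.finite_ker (h : IsTreeCoupling m ρ Φ κ ℓ)
    (hΨ : ∀ v, IsAtomicMap m (smallCoupling φ Φ v) (α v) (β v) (Ψ v)) (v : Vertex φ) :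
    Finite (β v).ker := by
  obtain ⟨ℓ', hℓ', hv⟩ := h.vertex v
  obtain ⟨g, hg⟩ := (hΨ v).exists_atom hv h.left_ne_zero
  exact ((hΨ v).commensurable hv h.left_ne_top (ne_top_of_le_ne_top h.right_ne_top hℓ') hg).1

theorem IsTreeCoupling.finitelyManyOrbits_vertexClass (h : IsTreeCoupling m ρ Φ κ ℓ)
    (hα : ∀ v, IsVertexHom v (π v.1) (α v))
    (hΨ : ∀ v, IsAtomicMap m (smallCoupling φ Φ v) (α v) (β v) (Ψ v)) {N : ℕ}
    (hN : ∀ v, Nat.card (β v).ker ≤ N) {i : Fin 2} (hV : ConditionV (π i)) :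
    FinitelyManyOrbits ρ ⊤ (vertexClass φ i) := by
  obtain ⟨M, hM, hV⟩ := hV.exists_le
  have hfin := h.total.finite_orbits h.perm (U := vertexClass φ i)
    (ae_of_all _ fun x _ u => autT_mem_vertexClass (Φ x) i u) exists_smul_of_mem_vertexClass
    h.right_ne_top (ε := κ / (N * M))
    (ENNReal.div_pos h.left_ne_zero (ENNReal.mul_ne_top (ENNReal.natCast_ne_top _) hM))
    (fun v hv ℓ' hℓ' hc => by
      rw [top_inf_eq, top_inf_eq, Set.univ_inter, ← h.actingStab_eq, ← amalgamStab_eq] at hc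
      have hi : v.1 = i := hv
      subst hi
      refine (hΨ v).covolume_le hc h.left_ne_top (ne_top_of_le_ne_top h.right_ne_top hℓ')
        (fun _ => hN v) fun g _ hcomm => ?_
      rw [(hα v).range_eq] at hcomm ⊢
      exact hV _ hcomm)
  refine hfin.subset ?_
  rintro O ⟨u, hu, rfl⟩
  refine ⟨u, hu, ?_⟩
  simp only [h.smul_eq]
  rfl

/-- If `A` is its own left quasi-normalizer in both factors and condition (F) holds, then the
kernels of the homomorphisms at adjacent vertices are the same subgroup of `Λ`. -/
theorem IsTreeCoupling.ker_eq (h : IsTreeCoupling m ρ Φ κ ℓ)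
    (hφ : ∀ i, Function.Injective (φ i)) (hα : ∀ v, IsVertexHom v (π v.1) (α v))
    (hΨ : ∀ v, IsAtomicMap m (smallCoupling φ Φ v) (α v) (β v) (Ψ v))
    (hq : ∀ i, leftQuasiNormalizer (φ i).range = ((φ i).range : Set (Γ i)))
    (hF : ∀ i, ConditionF (φ i).range (π i)) (u v : Vertex φ) :
    (β u).ker.map (actingStab φ ρ u).subtype = (β v).ker.map (actingStab φ ρ v).subtype := by
  have key : ∀ u v, (bassSerreTree φ).Adj u v →
      (β u).ker.map (actingStab φ ρ u).subtype ≤ (β v).ker.map (actingStab φ ρ v).subtype := by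
    intro u v huv
    have := h.finite_ker hΨ u
    have hfin : Finite ((β u).ker.map (actingStab φ ρ u).subtype) :=
      Finite.of_surjective _ ((actingStab φ ρ u).subtype.subgroupMap_surjective (β u).ker)
    have hle : (β u).ker.map (actingStab φ ρ u).subtype ≤ actingStab φ ρ u :=
      Subgroup.map_subtype_le _
    exact h.le_ker_of_conditionF (hα v) (hΨ v) (hF v.1) huv.symm hfin
      (le_inf (h.le_actingStab_of_adj hφ (hq u.1) huv hfin hle (conj_mem_map_ker _)) hle)
      fun l hl => conj_mem_map_ker _ l hl.2
  exact eq_of_forall_adj (fun v => (β v).ker.map (actingStab φ ρ v).subtype)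
    (fun u v huv => le_antisymm (key u v huv) (key v u huv.symm)) u v

end Kernels

end AmalgamME

theorem proposition5p13
    -- the amalgamated free product `PushoutI φ` of two countable groups
    {A : Type*} {Γ : Fin 2 → Type*} [Group A] [∀ i, Group (Γ i)] [∀ i, Countable (Γ i)]
    (φ : ∀ i, A →* Γ i) (hφ : ∀ i, Function.Injective (φ i))
    -- a coupling of it with a countable group `Λ`
    {Λ : Type*} [Group Λ] [Countable Λ]
    {S : Type*} [MeasurableSpace S] [StandardBorelSpace S] [MulAction (Monoid.PushoutI φ × Λ) S]
    (m : MeasureTheory.Measure S) (hm : IsCoupling (Monoid.PushoutI φ) Λ m)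
    -- the representation of `Λ` and the equivariant map into `Aut(T)`
    (ρ : Λ →* AutT φ) (Φ : S → AutT φ) (hΦ : Measurable Φ)
    (hΦeq : AlmostEquivariant m (treeAction φ) ρ Φ)
    -- the standard Borel groups with respect to which the factors are coupling rigid
    {G : Fin 2 → Type*} [∀ i, Group (G i)] [∀ i, MeasurableSpace (G i)]
    [∀ i, StandardBorelSpace (G i)] [∀ i, MeasurableMul₂ (G i)] [∀ i, MeasurableInv (G i)]
    (π : ∀ i, Γ i →* G i) (hker : ∀ i, Finite (π i).ker)
    (hrigid : ∀ i, CouplingRigid (π i)) (hdom : ∀ i, HasBorelFundamentalDomain (π i))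
    -- the images of the vertex couplings are atomic
    (hatomic : ∀ v : Vertex φ, HasAtomicVertexImage hφ m ρ Φ π v) :
    (∀ i, ConditionE (φ i).range (π i) → ∀ v ∈ vertexClass φ i,
      FinitelyManyOrbits ρ (actingStab φ ρ v) ((bassSerreTree φ).neighborSet v)) ∧
    (∀ i, ConditionV (π i) → ConditionB Λ → FinitelyManyOrbits ρ ⊤ (vertexClass φ i)) ∧
    ((∀ i, ConditionV (π i)) → (∀ i, ConditionE (φ i).range (π i)) → ConditionB Λ →
      IsCocompact ρ) ∧
    ((∀ i, (φ i).range ≠ ⊤ ∧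
        leftQuasiNormalizer (φ i).range = ((φ i).range : Set (Γ i))) →
      (∀ i, ConditionF (φ i).range (π i)) →
      (∀ i, ConditionV (π i) → FinitelyManyOrbits ρ ⊤ (vertexClass φ i)) ∧
      ((∀ i, ConditionV (π i)) → (∀ i, ConditionE (φ i).range (π i)) → IsCocompact ρ)) := by
  have : Countable (Monoid.PushoutI φ) := countable_pushoutI hφ
  let _ : MulAction (Monoid.PushoutI φ) S :=
    MulAction.compHom S (MonoidHom.inl (Monoid.PushoutI φ) Λ)
  let _ : MulAction Λ S := MulAction.compHom S (MonoidHom.inr (Monoid.PushoutI φ) Λ)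
  let _ : MulAction Λ (Vertex φ) := MulAction.compHom (Vertex φ) ρ
  have hsmul : ∀ (γ : Monoid.PushoutI φ) (l : Λ) (x : S), (γ, l) • x = γ • l • x := fun γ l x => by
    change _ = ((γ, 1) : Monoid.PushoutI φ × Λ) • ((1, l) : Monoid.PushoutI φ × Λ) • x
    rw [← mul_smul, Prod.mk_mul_mk, mul_one, one_mul]
  have _ : MeasurableConstSMul (Monoid.PushoutI φ) S :=
    ⟨fun γ => (hm.measurePreserving (γ, 1)).measurable⟩
  have _ : MeasurableConstSMul Λ S := ⟨fun l => (hm.measurePreserving (1, l)).measurable⟩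
  have _ : SMulInvariantMeasure (Monoid.PushoutI φ) S m :=
    ⟨fun γ _ hs => (hm.measurePreserving (γ, 1)).measure_preimage hs.nullMeasurableSet⟩
  have _ : SMulInvariantMeasure Λ S m :=
    ⟨fun l _ hs => (hm.measurePreserving (1, l)).measure_preimage hs.nullMeasurableSet⟩
  have _ : SMulCommClass (Monoid.PushoutI φ) Λ S := ⟨fun γ l x => by
    rw [← hsmul]
    change _ = ((1, l) : Monoid.PushoutI φ × Λ) • ((γ, 1) : Monoid.PushoutI φ × Λ) • x
    rw [← mul_smul, Prod.mk_mul_mk, mul_one, one_mul]⟩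
  obtain ⟨κ, ℓ, hκ0, hκ, hℓ, hSC⟩ := hm.exists_isSubcoupling (fun _ _ => rfl) (fun _ _ => rfl)
  have h : IsTreeCoupling m ρ Φ κ ℓ := by
    refine ⟨fun _ _ => rfl, hSC, ⟨fun u v => hΦ (measurableSet_apply_eq u v), fun γ => ?_,
      fun l => ?_⟩, hκ0, hκ, hℓ⟩
    · filter_upwards [hΦeq γ 1] with x hx u
      rw [map_one, inv_one, mul_one] at hx
      exact congrArg (fun f : AutT φ => f.1 u) hx
    · filter_upwards [hΦeq 1 l] with x hx u
      rw [map_one, one_mul] at hx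
      refine (congrArg (fun f : AutT φ => f.1 (l • u)) hx).trans ?_
      exact congrArg (Φ x).1 (inv_smul_smul (ρ l) u)
  choose γv hγv β Ψ hΨm hΨeq hΨat using hatomic
  have hα : ∀ v, IsVertexHom v (π v.1) (vertexHom hφ π v (γv v) (hγv v)) := fun v =>
    ⟨range_vertexHom hφ π (hγv v), fun u hu => exists_range_vertexHom_edge hφ π (hγv v) hu⟩
  have hΨ : ∀ v, IsAtomicMap m (smallCoupling φ Φ v) (vertexHom hφ π v (γv v) (hγv v)) (β v)
      (Ψ v) := fun v => by
    have hms : MeasurableSet (smallCoupling φ Φ v) := hΦ (measurableSet_apply_eq v v)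
    refine ⟨hΨm v, fun γ => ?_, fun l => ?_, finite_ker_vertexHom hφ π (hγv v) (hker v.1), ?_⟩
    · filter_upwards [(ae_restrict_iff' hms).1 (hΨeq v γ 1)] with x hx hxE
      have := hx hxE
      rw [map_one, inv_one, mul_one] at this
      exact this
    · filter_upwards [(ae_restrict_iff' hms).1 (hΨeq v 1 l)] with x hx hxE
      have := hx hxE
      rw [map_one, one_mul] at this
      exact this
    · obtain ⟨C, hC, hC0⟩ := hΨat v
      refine ⟨C, hC, ?_⟩
      rw [Measure.map_apply (hΨm v) hC.measurableSet.compl] at hC0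
      exact (ae_restrict_iff' hms).1 hC0
  have hlink : ∀ v, ConditionE (φ v.1).range (π v.1) →
      FinitelyManyOrbits ρ (actingStab φ ρ v) ((bassSerreTree φ).neighborSet v) := fun v hE =>
    h.finitelyManyOrbits_link (hα v) (hΨ v) hE
  have hB : ConditionB Λ → ∃ N : ℕ, ∀ v, Nat.card (β v).ker ≤ N := by
    rintro ⟨N, hN⟩
    refine ⟨N, fun v => ?_⟩
    have := h.finite_ker hΨ v
    have hfin : Finite ((β v).ker.map (actingStab φ ρ v).subtype) :=
      Finite.of_surjective _ ((actingStab φ ρ v).subtype.subgroupMap_surjective (β v).ker)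
    have h1 := hN _ hfin
    rwa [Subgroup.card_map_of_injective (Subgroup.subtype_injective _)] at h1
  have hclass : (∃ N : ℕ, ∀ v, Nat.card (β v).ker ≤ N) → ∀ i, ConditionV (π i) →
      FinitelyManyOrbits ρ ⊤ (vertexClass φ i) := by
    rintro ⟨N, hN⟩ i hV
    exact h.finitelyManyOrbits_vertexClass hα hΨ hN hV
  refine ⟨fun i hE v hv => ?_, fun i hV hb => hclass (hB hb) i hV, fun hV hE hb => ?_,
    fun hA hF => ?_⟩
  · have hi : v.1 = i := hv
    subst hi
    exact hlink v hE
  · exact isCocompact_of_finitelyManyOrbits (fun i => hclass (hB hb) i (hV i))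
      fun v => hlink v (hE v.1)
  · have hN : ∃ N : ℕ, ∀ v, Nat.card (β v).ker ≤ N := by
      refine ⟨Nat.card (β (coset φ 0 1)).ker, fun v => ?_⟩
      have h1 := h.ker_eq hφ hα hΨ (fun i => (hA i).2) hF v (coset φ 0 1)
      rw [← Subgroup.card_map_of_injective (Subgroup.subtype_injective (actingStab φ ρ v)), h1,
        Subgroup.card_map_of_injective (Subgroup.subtype_injective _)]
    exact ⟨hclass hN, fun hV hE => isCocompact_of_finitelyManyOrbits
      (fun i => hclass hN i (hV i)) fun v => hlink v (hE v.1)⟩
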